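/- Let $S$ be a finite set of primes, $\mathbb{Q}_S=\prod_{p\in S}\mathbb{Q}_p$, $\mathbb{Z}_S=\prod_{p\in S}\mathbb{Z}_p$, and let $dx$ be the Haar measure on $\mathbb{Q}_S$ with $\int_{\mathbb{Z}_S}dx=1$. Put $\chi(x)=\prod_{p\in S}e^{2\pi i\{x_p\}_p}$, where $\{\cdot\}_p$ is the $p$-adic fractional part, and let $\mathcal{F}$ be the Fourier transform on $L^2(\mathbb{Q}_S)$, i.e. the continuous extension of $\varphi\mapsto\widehat\varphi(\xi)=\int\varphi(x)\chi(\xi x)\,dx$ from the locally constant functions with compact support. For an integer $n\ge 0$ let $e^{\psi(n)}$ be the least common multiple of the prime powers $p^l\le n$ with $p\in S$, $l\ge 0$ (and $1$ if $n=0$), and let $\psi(-n)=-\psi(n)$. For $x\in\mathbb{Q}_S\setminus\{0\}$ let $\|x\|=e^{-\psi(\mathrm{ord}(x))}$ with $\mathrm{ord}(x)=\max\{n\in\mathbb{Z}: x\in e^{\psi(n)}\mathbb{Z}_S\}$, and let $\|0\|=0$. For $\alpha>0$ let $D^\alpha f=\mathcal{F}^{-1}(\|\xi\|^\alpha\mathcal{F}f)$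 with domain $\mathrm{Dom}(D^\alpha)=\{f\in L^2(\mathbb{Q}_S): \|\xi\|^\alpha\mathcal{F}f\in L^2(\mathbb{Q}_S)\}$, and for $t>0$ let $$Z(x,t)=\int_{\mathbb{Q}_S}\chi(-x\xi)\,e^{-t\|\xi\|^\alpha}\,d\xi .$$ **Theorem.** The integral defining $Z(x,t)$ converges absolutely for all $x\in\mathbb{Q}_S$ and $t>0$. There is exactly one $C_0$-semigroup $\mathbf{S}(t)=\exp(-tD^\alpha)$, $t\ge 0$, on $L^2(\mathbb{Q}_S)$ with infinitesimal generator $-D^\alpha$, and it is smoothing: $\mathbf{S}(t)f\in\mathrm{Dom}(D^\alpha)$ for every $t>0$ and every $f\in L^2(\mathbb{Q}_S)$. Moreover, for every $f\in L^2(\mathbb{Q}_S)$ the Cauchy problem $$\frac{\partial u}{\partial t}(\cdot,t)+D^\alpha u(\cdot,t)=0\quad(t>0),\qquad u(\cdot,0)=f,$$ has exactly one solution $u:[0,\infty)\to L^2(\mathbb{Q}_S)$, where a solution is a function that is continuous on $[0,\infty)$, continuously differentiable on $(0,\infty)$ with respect to the $L^2$-norm, takes values in $\mathrm{Dom}(D^\alpha)$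 for $t>0$, and satisfies the two equations. This solution is $u(\cdot,t)=\mathbf{S}(t)f$ for $t\ge 0$, and for every $t>0$ $$u(x,t)=\int_{\mathbb{Q}_S}f(x-y)\,Z(y,t)\,dy\qquad\text{for almost every }x\in\mathbb{Q}_S,$$ where the integral converges absolutely for every $x$. -/

import Mathlib

open MeasureTheory Filter Topology
open scoped NNReal ENNReal

noncomputable section

namespace SAdic

/-! ### The ring `ℚ_S` and its Haar measure -/

instance factPrime (p : Nat.Primes) : Fact (p : ℕ).Prime := ⟨p.2⟩

/-- The Borel `σ`-algebra of `ℚ_p`. -/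
instance padicMeasurableSpace (p : ℕ) [Fact p.Prime] : MeasurableSpace ℚ_[p] := borel _

instance padicBorelSpace (p : ℕ) [Fact p.Prime] : BorelSpace ℚ_[p] := ⟨rfl⟩

/-- `ℚ_S = ∏_{p ∈ S} ℚ_p` for a finite set `S` of primes, with componentwise ring operations, the
product topology and the product (= Borel) `σ`-algebra. The norm which Mathlib puts on this product
is the maximum of the `p`-adic norms; it is not the norm `ultraNorm` below. -/
abbrev QS (S : Finset Nat.Primes) : Type := ∀ p : S, ℚ_[((p : Nat.Primes) : ℕ)]

/-- `ℤ_S = ∏_{p ∈ S} ℤ_p`, a compact set with non-empty interior. -/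
def ZS (S : Finset Nat.Primes) : TopologicalSpace.PositiveCompacts (QS S) where
  carrier := {x | ∀ p, ‖x p‖ ≤ 1}
  isCompact' := by
    have h : {x : QS S | ∀ p, ‖x p‖ ≤ 1} = Metric.closedBall 0 1 := by
      ext x
      simp [pi_norm_le_iff_of_nonneg zero_le_one]
    rw [h]
    exact isCompact_closedBall 0 1
  interior_nonempty' := by
    have h : {x : QS S | ∀ p, ‖x p‖ ≤ 1} = Metric.closedBall 0 1 := by
      ext x
      simp [pi_norm_le_iff_of_nonneg zero_le_one]
    rw [h]
    exact ⟨0, Metric.ball_subset_interior_closedBall (Metric.mem_ball_self one_pos)⟩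

/-- The Haar measure of `(ℚ_S, +)` with total mass one on `ℤ_S`. -/
def haar (S : Finset Nat.Primes) : Measure (QS S) := Measure.addHaarMeasure (ZS S)

instance haarIsAddHaar (S : Finset Nat.Primes) : (haar S).IsAddHaarMeasure :=
  Measure.isAddHaarMeasure_addHaarMeasure _

/-! ### The second Chebyshev function of `S` and the ultrametric norm of `ℚ_S` -/

open Classical in
/-- `e^{ψ(n)} = lcm {p ^ l ≤ n : p ∈ S, l ≥ 0}` for a natural number `n` (and `1` for `n = 0`). -/
def expPsiNat (S : Finset Nat.Primes) (n : ℕ) : ℕ :=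
  ((Finset.Icc 1 n).filter fun m => ∃ p ∈ S, ∃ l : ℕ, m = (p : ℕ) ^ l).lcm id

/-- `e^{ψ(n)}` for an integer `n`, where `ψ(-n) = -ψ(n)`. -/
def expPsi (S : Finset Nat.Primes) (n : ℤ) : ℚ :=
  if 0 ≤ n then (expPsiNat S n.natAbs : ℚ) else (expPsiNat S n.natAbs : ℚ)⁻¹

/-- The subgroup `e^{ψ(n)} ℤ_S` of `ℚ_S`. -/
def lattice (S : Finset Nat.Primes) (n : ℤ) : Set (QS S) :=
  {x | ∃ z : QS S, z ∈ ZS S ∧ ∀ p, x p = (expPsi S n : ℚ_[((p : Nat.Primes) : ℕ)]) * z p}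

/-- The order of a nonzero `x`: the largest integer `n` with `x ∈ e^{ψ(n)} ℤ_S`. -/
def order (S : Finset Nat.Primes) (x : QS S) : ℤ := sSup {n : ℤ | x ∈ lattice S n}

open Classical in
/-- The norm `‖x‖ = e^{-ψ(ord x)}` of `ℚ_S`, with `‖0‖ = 0`. -/
def ultraNorm {S : Finset Nat.Primes} (x : QS S) : ℝ :=
  if x = 0 then 0 else ((expPsi S (order S x) : ℚ) : ℝ)⁻¹

/-! ### The canonical additive character of `ℚ_S` -/

section Character

variable {p : ℕ} [hp : Fact p.Prime]

/-- Multiplication by `p ^ m`, where `m = max (-ord_p x) 0`, makes `x` a `p`-adic integer. -/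
theorem norm_pow_mul_le_one (x : ℚ_[p]) : ‖(p : ℚ_[p]) ^ (-x.valuation).toNat * x‖ ≤ 1 := by
  by_cases hx : x = 0
  · simp [hx]
  have hp1 : (1 : ℝ) < p := by exact_mod_cast hp.1.one_lt
  have hp0 : (0 : ℝ) < p := by linarith
  rw [norm_mul, norm_pow, Padic.norm_p, Padic.norm_eq_zpow_neg_valuation hx, inv_pow,
    ← zpow_natCast, ← zpow_neg, ← zpow_add₀ hp0.ne']
  apply zpow_le_one_of_nonpos₀ hp1.le
  omega

/-- The fractional part `{x}_p`: if `x = p ^ (-m) * (a₀ + a₁ p + a₂ p² + ⋯)` with `m ≥ 0`, then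
`{x}_p = p ^ (-m) * (a₀ + ⋯ + a_{m-1} p ^ (m-1))`. -/
def fracPart (x : ℚ_[p]) : ℝ :=
  (PadicInt.appr (⟨_, norm_pow_mul_le_one x⟩ : ℤ_[p]) (-x.valuation).toNat : ℝ) /
    (p : ℝ) ^ (-x.valuation).toNat

/-- The canonical character `χ_p(x) = exp(2πi {x}_p)` of `ℚ_p`. -/
def padicChar (x : ℚ_[p]) : ℂ := Complex.exp (2 * Real.pi * Complex.I * (fracPart x : ℂ))

theorem exists_fracPart (x : ℚ_[p]) : ∃ (a : ℤ) (n : ℕ),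
    ‖x - (a : ℚ_[p]) / (p : ℚ_[p]) ^ n‖ ≤ 1 ∧ fracPart x = (a : ℝ) / (p : ℝ) ^ n := by
  set m := (-x.valuation).toNat with hm
  set z : ℤ_[p] := ⟨(p : ℚ_[p]) ^ m * x, norm_pow_mul_le_one x⟩ with hz
  refine ⟨(PadicInt.appr z m : ℕ), m, ?_, by simp [fracPart, hz, hm]⟩
  have h := (PadicInt.norm_le_pow_iff_mem_span_pow _ m).2 (PadicInt.appr_spec m z)
  have hp0 : (p : ℚ_[p]) ≠ 0 := by exact_mod_cast hp.1.ne_zero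
  have hpr : (0 : ℝ) < p := by exact_mod_cast hp.1.pos
  rw [← PadicInt.padic_norm_e_of_padicInt] at h
  push_cast at h
  have e : x - ((PadicInt.appr z m : ℕ) : ℤ) / (p : ℚ_[p]) ^ m
      = ((z : ℚ_[p]) - (PadicInt.appr z m : ℕ)) / (p : ℚ_[p]) ^ m := by
    rw [hz]; push_cast; field_simp
  rw [e, norm_div, norm_pow, Padic.norm_p, div_le_one (by positivity)]
  calc _ ≤ _ := h
    _ = _ := by rw [zpow_neg, zpow_natCast, inv_pow]

theorem padicChar_eq {x : ℚ_[p]} {a : ℤ} {n : ℕ}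
    (h : ‖x - (a : ℚ_[p]) / (p : ℚ_[p]) ^ n‖ ≤ 1) :
    padicChar x = Complex.exp (2 * Real.pi * Complex.I * (a / (p : ℂ) ^ n)) := by
  obtain ⟨b, m, hb, hf⟩ := exists_fracPart x
  have hp0 : (p : ℚ_[p]) ≠ 0 := by exact_mod_cast hp.1.ne_zero
  have hpc : (p : ℂ) ≠ 0 := by exact_mod_cast hp.1.ne_zero
  have hpr : (0 : ℝ) < p := by exact_mod_cast hp.1.pos
  have h1 : ‖((b * p ^ n - a * p ^ m : ℤ) : ℚ_[p]) / (p : ℚ_[p]) ^ (n + m)‖ ≤ 1 := by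
    have e : ((b * p ^ n - a * p ^ m : ℤ) : ℚ_[p]) / (p : ℚ_[p]) ^ (n + m)
        = (x - (a : ℚ_[p]) / (p : ℚ_[p]) ^ n) - (x - (b : ℚ_[p]) / (p : ℚ_[p]) ^ m) := by
      push_cast; field_simp; ring
    rw [e]
    rw [sub_eq_add_neg]
    exact (Padic.nonarchimedean _ _).trans (by rw [norm_neg]; exact max_le h hb)
  rw [norm_div, norm_pow, Padic.norm_p, div_le_one (by positivity), inv_pow,
    ← zpow_natCast, ← zpow_neg, Padic.norm_int_le_pow_iff_dvd] at h1
  obtain ⟨k, hk⟩ := h1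
  have hk' : (b : ℂ) * (p : ℂ) ^ n - a * (p : ℂ) ^ m = (p : ℂ) ^ (n + m) * k := by
    exact_mod_cast hk
  rw [padicChar, hf, Complex.exp_eq_exp_iff_exists_int]
  refine ⟨k, ?_⟩
  push_cast
  have : (b : ℂ) / (p : ℂ) ^ m = a / (p : ℂ) ^ n + k := by
    field_simp
    rw [pow_add] at hk'
    linear_combination hk'
  rw [this]
  ring

theorem padicChar_eq_one {x : ℚ_[p]} (h : ‖x‖ ≤ 1) : padicChar x = 1 := by
  rw [padicChar_eq (x := x) (a := 0) (n := 0) (by simpa using h)]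
  simp

theorem padicChar_add (x y : ℚ_[p]) : padicChar (x + y) = padicChar x * padicChar y := by
  obtain ⟨a, n, ha, -⟩ := exists_fracPart x
  obtain ⟨b, m, hb, -⟩ := exists_fracPart y
  have hp0 : (p : ℚ_[p]) ≠ 0 := by exact_mod_cast hp.1.ne_zero
  have hpc : (p : ℂ) ≠ 0 := by exact_mod_cast hp.1.ne_zero
  have h : ‖x + y - ((a * p ^ m + b * p ^ n : ℤ) : ℚ_[p]) / (p : ℚ_[p]) ^ (n + m)‖ ≤ 1 := by
    have e : x + y - ((a * p ^ m + b * p ^ n : ℤ) : ℚ_[p]) / (p : ℚ_[p]) ^ (n + m)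
        = (x - (a : ℚ_[p]) / (p : ℚ_[p]) ^ n) + (y - (b : ℚ_[p]) / (p : ℚ_[p]) ^ m) := by
      push_cast; field_simp; ring
    rw [e]
    exact (Padic.nonarchimedean _ _).trans (max_le ha hb)
  rw [padicChar_eq h, padicChar_eq ha, padicChar_eq hb, ← Complex.exp_add]
  congr 1
  push_cast
  field_simp
  ring

theorem padicChar_inv_ne_one : padicChar ((p : ℚ_[p])⁻¹) ≠ 1 := by
  have hpc : (p : ℂ) ≠ 0 := by exact_mod_cast hp.1.ne_zero
  rw [padicChar_eq (a := 1) (n := 1) (by simp), Ne, Complex.exp_eq_one_iff]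
  rintro ⟨k, hk⟩
  have h2 : (2 * Real.pi * Complex.I : ℂ) ≠ 0 := Complex.two_pi_I_ne_zero
  have h3 : (1 : ℂ) = k * p := by
    have : ((1 : ℤ) : ℂ) / (p : ℂ) ^ 1 = k := by
      apply mul_left_cancel₀ h2
      linear_combination hk
    rw [← this]; field_simp; simp
  have h4 : (1 : ℤ) = k * p := by exact_mod_cast h3
  have h5 : (p : ℤ) ∣ 1 := ⟨k, by rw [h4]; ring⟩
  have := Int.natAbs_dvd_natAbs.2 h5
  simp at this
  exact hp.1.one_lt.ne' this

end Character

variable {S : Finset Nat.Primes}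

/-- The canonical character `χ(x) = ∏_{p ∈ S} χ_p(x_p)` of `ℚ_S`. -/
def char (x : QS S) : ℂ := ∏ p, padicChar (x p)

theorem char_add (x y : QS S) : char (x + y) = char x * char y := by
  simp [char, padicChar_add, Finset.prod_mul_distrib]

theorem char_eq_one {x : QS S} (h : ‖x‖ ≤ 1) : char x = 1 :=
  Finset.prod_eq_one fun p _ => padicChar_eq_one ((norm_le_pi_norm x p).trans h)

theorem isLocallyConstant_char : IsLocallyConstant (char : QS S → ℂ) := by
  rw [IsLocallyConstant.iff_eventually_eq]
  intro x
  filter_upwards [Metric.ball_mem_nhds x one_pos] with y hy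
  have h : char (y - x) = 1 := char_eq_one (by rw [← dist_eq_norm]; exact (Metric.mem_ball.1 hy).le)
  rw [← sub_add_cancel y x, char_add, h, one_mul]

/-! ### Test functions and the Fourier transform on `L²(ℚ_S)` -/

/-- The Bruhat–Schwartz space `𝒟(ℚ_S)`: locally constant functions with compact support. -/
def testFun (S : Finset Nat.Primes) : Submodule ℂ (QS S → ℂ) where
  carrier := {φ | IsLocallyConstant φ ∧ HasCompactSupport φ}
  zero_mem' := ⟨IsLocallyConstant.const 0, HasCompactSupport.zero⟩
  add_mem' hφ hψ := ⟨hφ.1.add hψ.1, hφ.2.add hψ.2⟩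
  smul_mem' c _ hφ := ⟨hφ.1.comp (c * ·), hφ.2.comp_left (g := (c * ·)) (mul_zero c)⟩

/-- `φ̂(ξ) = ∫ φ(x) χ(ξ x) dx`. -/
def fourier (φ : QS S → ℂ) (ξ : QS S) : ℂ := ∫ x, φ x * char (ξ * x) ∂(haar S)

/-- `φ̌(x) = ∫ φ(ξ) χ(-x ξ) dξ`. -/
def fourierInv (φ : QS S → ℂ) (x : QS S) : ℂ := ∫ ξ, φ ξ * char (-(x * ξ)) ∂(haar S)

theorem fourierInv_eq (φ : QS S → ℂ) (x : QS S) : fourierInv φ x = fourier φ (-x) := by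
  simp [fourierInv, fourier]

theorem integrable_testFun_mul_char {φ : QS S → ℂ} (hφ : φ ∈ testFun S) (ξ : QS S) :
    Integrable (fun x => φ x * char (ξ * x)) (haar S) :=
  (hφ.1.continuous.mul (isLocallyConstant_char.continuous.comp
    (continuous_const.mul continuous_id))).integrable_of_hasCompactSupport hφ.2.mul_right

theorem testFun_uniform {φ : QS S → ℂ} (hφ : φ ∈ testFun S) :
    ∃ δ > 0, ∀ x y, ‖y‖ < δ → φ (x + y) = φ x := by
  obtain ⟨δ, hδ, h⟩ := lebesgue_number_lemma_of_metric (c := fun c : ℂ => φ ⁻¹' {c}) hφ.2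
    (fun c => hφ.1.isOpen_fiber c) (fun x _ => Set.mem_iUnion.2 ⟨φ x, rfl⟩)
  have key : ∀ x ∈ tsupport φ, ∀ y, ‖y‖ < δ → φ (x + y) = φ x := by
    intro x hx y hy
    obtain ⟨c, hc⟩ := h x hx
    have h1 : φ x = c := hc (Metric.mem_ball_self hδ)
    have h2 : φ (x + y) = c := hc (by simpa [dist_eq_norm] using hy)
    rw [h1, h2]
  refine ⟨δ, hδ, fun x y hy => ?_⟩
  by_cases hx : x ∈ tsupport φ
  · exact key x hx y hy
  by_cases hxy : x + y ∈ tsupport φ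
  · have := key (x + y) hxy (-y) (by rwa [norm_neg])
    rw [add_neg_cancel_right] at this
    exact this.symm
  · rw [image_eq_zero_of_notMem_tsupport hx, image_eq_zero_of_notMem_tsupport hxy]

theorem exists_char_ne_one {δ : ℝ} (hδ : 0 < δ) :
    ∃ R : ℝ, ∀ ξ : QS S, R < ‖ξ‖ → ∃ y : QS S, ‖y‖ < δ ∧ char (ξ * y) ≠ 1 := by
  classical
  refine ⟨∑ p : S, (((p : Nat.Primes) : ℕ) : ℝ) / δ, fun ξ hξ => ?_⟩
  have hR : (0 : ℝ) ≤ ∑ p : S, (((p : Nat.Primes) : ℕ) : ℝ) / δ := by positivity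
  obtain ⟨p, hp⟩ : ∃ p : S, (((p : Nat.Primes) : ℕ) : ℝ) / δ < ‖ξ p‖ := by
    by_contra! hcon
    refine hξ.not_ge ((pi_norm_le_iff_of_nonneg hR).2 fun p => (hcon p).trans ?_)
    exact Finset.single_le_sum (f := fun p : S => (((p : Nat.Primes) : ℕ) : ℝ) / δ)
      (fun q _ => by positivity) (Finset.mem_univ p)
  have hpp : (0 : ℝ) < ((p : Nat.Primes) : ℕ) := by exact_mod_cast (p : Nat.Primes).2.pos
  have hξp : 0 < ‖ξ p‖ := lt_trans (by positivity) hp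
  have hξ0 : ξ p ≠ 0 := norm_pos_iff.1 hξp
  refine ⟨Pi.single p ((((p : Nat.Primes) : ℕ) : ℚ_[((p : Nat.Primes) : ℕ)])⁻¹ * (ξ p)⁻¹), ?_, ?_⟩
  · rw [Pi.norm_single, norm_mul, norm_inv, norm_inv, Padic.norm_p, inv_inv, ← div_eq_mul_inv,
      div_lt_iff₀ hξp]
    rwa [div_lt_iff₀ hδ, mul_comm] at hp
  · rw [char, Finset.prod_eq_single p]
    · have e : ξ p * ((((p : Nat.Primes) : ℕ) : ℚ_[((p : Nat.Primes) : ℕ)])⁻¹ * (ξ p)⁻¹)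
          = (((p : Nat.Primes) : ℕ) : ℚ_[((p : Nat.Primes) : ℕ)])⁻¹ := by
        field_simp
      rw [Pi.mul_apply, Pi.single_eq_same, e]
      exact padicChar_inv_ne_one
    · intro q _ hq
      rw [Pi.mul_apply, Pi.single_eq_of_ne hq, mul_zero]
      exact padicChar_eq_one (by simp)
    · exact fun h => absurd (Finset.mem_univ p) h

/-- The Fourier transform maps test functions to test functions. -/
theorem fourier_mem_testFun {φ : QS S → ℂ} (hφ : φ ∈ testFun S) : fourier φ ∈ testFun S := by
  constructor
  · obtain ⟨R, hR0, hR⟩ := hφ.2.isCompact.isBounded.exists_pos_norm_le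
    rw [IsLocallyConstant.iff_eventually_eq]
    intro ξ
    filter_upwards [Metric.ball_mem_nhds ξ (inv_pos.2 hR0)] with η hη
    refine integral_congr_ae (Eventually.of_forall fun x => ?_)
    by_cases hx : x ∈ tsupport φ
    · have h1 : ‖(η - ξ) * x‖ ≤ 1 := by
        have h2 : ‖η - ξ‖ ≤ R⁻¹ := by rw [← dist_eq_norm]; exact (Metric.mem_ball.1 hη).le
        calc _ ≤ ‖η - ξ‖ * ‖x‖ := norm_mul_le _ _
          _ ≤ R⁻¹ * R := by
            have := hR x hx
            gcongr
          _ = 1 := inv_mul_cancel₀ hR0.ne'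
      have h3 : η * x = (η - ξ) * x + ξ * x := by ring
      simp only [h3, char_add, char_eq_one h1, one_mul]
    · simp [image_eq_zero_of_notMem_tsupport hx]
  · obtain ⟨δ, hδ, h⟩ := testFun_uniform hφ
    obtain ⟨R, hR⟩ := exists_char_ne_one (S := S) hδ
    refine HasCompactSupport.intro (isCompact_closedBall (0 : QS S) R) fun ξ hξ => ?_
    obtain ⟨y, hy, hχ⟩ := hR ξ (by simpa using hξ)
    have h1 : fourier φ ξ = fourier φ ξ * char (ξ * y) := by
      conv_lhs => rw [fourier, ← integral_add_right_eq_self _ y]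
      rw [fourier, ← integral_mul_const]
      refine integral_congr_ae (Eventually.of_forall fun x => ?_)
      simp only [h x y hy, mul_add, char_add]
      ring
    have h2 : fourier φ ξ * (char (ξ * y) - 1) = 0 := by linear_combination -h1
    exact (mul_eq_zero.1 h2).resolve_right (sub_ne_zero.2 hχ)

theorem fourierInv_mem_testFun {φ : QS S → ℂ} (hφ : φ ∈ testFun S) :
    fourierInv φ ∈ testFun S := by
  have h : fourierInv φ = fun x => fourier φ (-x) := funext (fourierInv_eq φ)
  rw [h]
  exact ⟨(fourier_mem_testFun hφ).1.comp_continuous continuous_neg,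
    (fourier_mem_testFun hφ).2.comp_homeomorph (Homeomorph.neg _)⟩

/-- The Fourier transform `𝒟(ℚ_S) → 𝒟(ℚ_S)`. -/
def fourierTest (S : Finset Nat.Primes) : testFun S →ₗ[ℂ] testFun S where
  toFun φ := ⟨fourier φ, fourier_mem_testFun φ.2⟩
  map_add' φ ψ := by
    ext ξ
    simp only [fourier, Submodule.coe_add, Pi.add_apply, add_mul]
    exact integral_add (integrable_testFun_mul_char φ.2 ξ) (integrable_testFun_mul_char ψ.2 ξ)
  map_smul' c φ := by
    ext ξ
    simp only [fourier, Submodule.coe_smul, Pi.smul_apply, smul_eq_mul, mul_assoc, RingHom.id_apply]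
    exact integral_const_mul c _

/-- The inverse Fourier transform `𝒟(ℚ_S) → 𝒟(ℚ_S)`. -/
def fourierInvTest (S : Finset Nat.Primes) : testFun S →ₗ[ℂ] testFun S where
  toFun φ := ⟨fourierInv φ, fourierInv_mem_testFun φ.2⟩
  map_add' φ ψ := by
    ext ξ
    have h := congrFun (congrArg Subtype.val ((fourierTest S).map_add φ ψ)) (-ξ)
    simp only [Submodule.coe_add, Pi.add_apply, fourierInv_eq]
    exact h
  map_smul' c φ := by
    ext ξ
    have h := congrFun (congrArg Subtype.val ((fourierTest S).map_smul c φ)) (-ξ)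
    simp only [Submodule.coe_smul, Pi.smul_apply, fourierInv_eq, RingHom.id_apply]
    exact h

/-- The Hilbert space `L²(ℚ_S)`. -/
abbrev L2 (S : Finset Nat.Primes) : Type := Lp ℂ 2 (haar S)

theorem memLp_testFun {φ : QS S → ℂ} (hφ : φ ∈ testFun S) : MemLp φ 2 (haar S) :=
  hφ.1.continuous.memLp_of_hasCompactSupport hφ.2

/-- The (dense) inclusion `𝒟(ℚ_S) → L²(ℚ_S)`. -/
def testToL2 (S : Finset Nat.Primes) : testFun S →ₗ[ℂ] L2 S where
  toFun φ := (memLp_testFun φ.2).toLp φ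
  map_add' φ ψ := MemLp.toLp_add (memLp_testFun φ.2) (memLp_testFun ψ.2)
  map_smul' c φ := MemLp.toLp_const_smul c (memLp_testFun φ.2)

/-- The Fourier transform `ℱ : L²(ℚ_S) → L²(ℚ_S)`, the extension by continuity of the Fourier
transform of test functions. -/
def fourierL2 (S : Finset Nat.Primes) : L2 S →L[ℂ] L2 S :=
  (testToL2 S ∘ₗ fourierTest S).extendOfNorm (testToL2 S)

/-- The inverse Fourier transform `ℱ⁻¹ : L²(ℚ_S) → L²(ℚ_S)`, the extension by continuity of the
inverse Fourier transform of test functions. -/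
def fourierInvL2 (S : Finset Nat.Primes) : L2 S →L[ℂ] L2 S :=
  (testToL2 S ∘ₗ fourierInvTest S).extendOfNorm (testToL2 S)

/-! ### The pseudodifferential operator `D^α` and the heat kernel -/

/-- The domain `{g ∈ L² : ‖ξ‖^α g ∈ L²}` of the operator of multiplication by `‖ξ‖^α`. -/
def mulDom (S : Finset Nat.Primes) (α : ℝ) : Submodule ℂ (L2 S) where
  carrier := {g | MemLp (fun ξ => ((ultraNorm ξ ^ α : ℝ) : ℂ) * g ξ) 2 (haar S)}
  zero_mem' := by
    refine (memLp_congr_ae ?_).2 (MemLp.zero (p := 2) (μ := haar S) (ε := ℂ))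
    filter_upwards [Lp.coeFn_zero ℂ 2 (haar S)] with ξ h
    rw [h, Pi.zero_apply, mul_zero]
  add_mem' := fun {g h} hg hh => by
    refine (memLp_congr_ae ?_).2 (MemLp.add hg hh)
    filter_upwards [Lp.coeFn_add g h] with ξ e
    rw [e, Pi.add_apply, Pi.add_apply, mul_add]
  smul_mem' := fun c g hg => by
    refine (memLp_congr_ae ?_).2 (MemLp.const_smul hg c)
    filter_upwards [Lp.coeFn_smul c g] with ξ e
    rw [e, Pi.smul_apply, Pi.smul_apply, mul_smul_comm]

/-- The operator `m^α` of multiplication by `‖ξ‖^α` in `L²(ℚ_S)`, with its maximal domain. -/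
def mulOp (S : Finset Nat.Primes) (α : ℝ) : L2 S →ₗ.[ℂ] L2 S where
  domain := mulDom S α
  toFun :=
    { toFun := fun g => MemLp.toLp (fun ξ => ((ultraNorm ξ ^ α : ℝ) : ℂ) * (g : L2 S) ξ) g.2
      map_add' := fun ⟨g, hg⟩ ⟨h, hh⟩ => by
        refine Eq.trans ?_ (MemLp.toLp_add hg hh)
        refine MemLp.toLp_congr _ _ ?_
        filter_upwards [Lp.coeFn_add g h] with ξ e
        rw [AddMemClass.mk_add_mk, e, Pi.add_apply, Pi.add_apply, mul_add]
      map_smul' := fun c ⟨g, hg⟩ => by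
        refine Eq.trans ?_ (MemLp.toLp_const_smul c hg)
        refine MemLp.toLp_congr _ _ ?_
        filter_upwards [Lp.coeFn_smul c g] with ξ e
        rw [SetLike.mk_smul_mk, e, Pi.smul_apply, Pi.smul_apply, mul_smul_comm] }

/-- `D^α f = ℱ⁻¹ (‖ξ‖^α ℱ f)` with domain `{f ∈ L² : ‖ξ‖^α ℱ f ∈ L²}`. -/
def Dop (S : Finset Nat.Primes) (α : ℝ) : L2 S →ₗ.[ℂ] L2 S where
  domain := (mulOp S α).domain.comap (fourierL2 S).toLinearMap
  toFun := (fourierInvL2 S).toLinearMap ∘ₗ (mulOp S α).toFun ∘ₗ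
    (fourierL2 S).toLinearMap.restrict (fun _ h => h)

/-- The heat kernel `Z(x, t) = ∫ χ(-x ξ) exp(-t ‖ξ‖^α) dξ`. -/
def heatKernel (α : ℝ) (x : QS S) (t : ℝ) : ℂ :=
  ∫ ξ, char (-(x * ξ)) * (Real.exp (-t * ultraNorm ξ ^ α) : ℂ) ∂(haar S)

/-! ### Semigroups and the Cauchy problem -/

section Semigroup

variable {E : Type*} [NormedAddCommGroup E] [NormedSpace ℂ E]

/-- A `C₀`-semigroup of bounded operators on `E`. -/
structure C0Semigroup (E : Type*) [NormedAddCommGroup E] [NormedSpace ℂ E] where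
  /-- the operator `T(t)`, `t ≥ 0` -/
  op : ℝ≥0 → E →L[ℂ] E
  op_zero : op 0 = ContinuousLinearMap.id ℂ E
  op_add : ∀ s t, op (s + t) = op s ∘L op t
  tendsto_zero : ∀ x, Tendsto (fun t => op t x) (𝓝 0) (𝓝 x)

/-- `y` is the right derivative at `0` of the orbit of `x` under `T`. -/
def C0Semigroup.HasGenerator (T : C0Semigroup E) (x y : E) : Prop :=
  Tendsto (fun t : ℝ≥0 => ((t : ℝ)⁻¹ : ℂ) • (T.op t x - x)) (𝓝[>] 0) (𝓝 y)

theorem C0Semigroup.HasGenerator.add {T : C0Semigroup E} {x y x' y' : E}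
    (h : T.HasGenerator x y) (h' : T.HasGenerator x' y') :
    T.HasGenerator (x + x') (y + y') := by
  refine (Tendsto.add h h').congr fun t => ?_
  rw [← smul_add, map_add]
  congr 1
  abel

theorem C0Semigroup.HasGenerator.smul {T : C0Semigroup E} {x y : E}
    (h : T.HasGenerator x y) (c : ℂ) : T.HasGenerator (c • x) (c • y) := by
  refine (Tendsto.const_smul h c).congr fun t => ?_
  rw [map_smul, ← smul_sub, smul_comm]

/-- The infinitesimal generator `x ↦ lim_{t → 0+} t⁻¹ (T(t) x - x)` of `T`, defined on all `x` for
which the limit exists. -/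
def C0Semigroup.generator (T : C0Semigroup E) : E →ₗ.[ℂ] E where
  domain :=
    { carrier := {x | ∃ y, T.HasGenerator x y}
      zero_mem' := ⟨0, by simp [C0Semigroup.HasGenerator]⟩
      add_mem' := fun ⟨y, h⟩ ⟨y', h'⟩ => ⟨y + y', h.add h'⟩
      smul_mem' := fun c _ ⟨y, h⟩ => ⟨c • y, h.smul c⟩ }
  toFun :=
    { toFun := fun x => x.2.choose
      map_add' := fun x y =>
        tendsto_nhds_unique (x + y).2.choose_spec (x.2.choose_spec.add y.2.choose_spec)
      map_smul' := fun c x =>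
        tendsto_nhds_unique (c • x).2.choose_spec (x.2.choose_spec.smul c) }

/-- `u : [0, ∞) → E` is a solution of the Cauchy problem `u'(t) + A u(t) = 0` for `t > 0`,
`u(0) = f`: it is continuous on `[0, ∞)`, continuously differentiable on `(0, ∞)`, takes values in
the domain of `A` for `t > 0` and satisfies the equation and the initial condition. (The values of
`u` at negative times are irrelevant.) -/
structure IsCauchySolution (A : E →ₗ.[ℂ] E) (f : E) (u : ℝ → E) : Prop where
  continuousOn : ContinuousOn u (Set.Ici 0)
  contDiffOn : ContDiffOn ℝ 1 u (Set.Ioi 0)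
  mem_domain : ∀ t, 0 < t → u t ∈ A.domain
  equation : ∀ t (ht : 0 < t), deriv u t + A ⟨u t, mem_domain t ht⟩ = 0
  initial : u 0 = f

end Semigroup

end SAdic

end

/-! The Fourier transform is unitary on `L2 S` and turns `D^α` into multiplication by `m = ‖ξ‖^α ≥
0`, so all operator-theoretic claims reduce to the contraction semigroup of multiplication by
`e^{-tm}`. Its generator is exactly `-m` with maximal domain (`hasGenerator_mulSemigroup_iff`): the
bound `|t⁻¹(e^{-tm} - 1)| ≤ m` permits dominated convergence, and conversely an `L²` limit is an
a.e. limit along a subsequence. Smoothing is the boundedness of `m e^{-tm}` for `t > 0`.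

Uniqueness, both of the semigroup and of the solution, is an energy argument. The generator of a
contraction semigroup is dissipative, so the norm of the difference of two solutions cannot increase
(`eq_zero_of_re_inner_deriv_nonpos`).

Unitarity (`norm_fourierL2` with the two inversion identities) comes from inversion on test
functions, which rests on the indicator of `ℤ_S` being its own transform. The kernel formula is
Parseval's identity (`coeFn_fourierInvL2_mul`). It requires `e^{-tm}` to be in `L¹ ∩ L²`, which
follows because balls of `ℚ_S` have volume polynomial in the radius (`haar_ball_le`), whereas
`e^{-tm}` decays faster than any power. -/

open scoped ComplexConjugate

noncomputable section

namespace SAdic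

namespace C0Semigroup

/-! ### `C₀`-semigroups on a normed space: orbits and their derivatives. -/

section Banach

variable {E : Type*} [NormedAddCommGroup E] [NormedSpace ℂ E] {T T' : C0Semigroup E} {x y : E}

theorem ext_op (h : ∀ t x, T.op t x = T'.op t x) : T = T' := by
  have h' : T.op = T'.op := funext fun t => ContinuousLinearMap.ext (h t)
  cases T; cases T'; simpa using h'

theorem op_add_apply (T : C0Semigroup E) (s t : ℝ≥0) (x : E) :
    T.op (s + t) x = T.op s (T.op t x) := by
  rw [T.op_add]; rfl

theorem op_comm_apply (T : C0Semigroup E) (s t : ℝ≥0) (x : E) :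
    T.op s (T.op t x) = T.op t (T.op s x) := by
  rw [← op_add_apply, add_comm, op_add_apply]

theorem op_zero_apply (T : C0Semigroup E) (x : E) : T.op 0 x = x := by
  rw [T.op_zero]; rfl

theorem HasGenerator.op (h : T.HasGenerator x y) (t : ℝ≥0) :
    T.HasGenerator (T.op t x) (T.op t y) := by
  refine (((T.op t).continuous.tendsto y).comp h).congr fun r => ?_
  simp only [Function.comp, map_smul, map_sub, T.op_comm_apply t r]

theorem HasGenerator.sub {x' y' : E} (h : T.HasGenerator x y) (h' : T.HasGenerator x' y') :
    T.HasGenerator (x - x') (y - y') := by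
  have := h.add (h'.smul (-1))
  simpa [sub_eq_add_neg] using this

theorem HasGenerator.generator_apply (h : T.HasGenerator x y) (hx : x ∈ T.generator.domain) :
    T.generator ⟨x, hx⟩ = y :=
  tendsto_nhds_unique (Exists.choose_spec hx) h

theorem hasGenerator_generator (hx : x ∈ T.generator.domain) :
    T.HasGenerator x (T.generator ⟨x, hx⟩) :=
  Exists.choose_spec hx

theorem HasGenerator.of_generator_eq (h : T.HasGenerator x y) (hT : T.generator = T'.generator) :
    T'.HasGenerator x y := by
  have hx : x ∈ T.generator.domain := ⟨y, h⟩
  have hx' : x ∈ T'.generator.domain := hT ▸ hx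
  have e := LinearPMap.dExt_iff.1 hT
  have h2 : T.generator ⟨x, hx⟩ = T'.generator ⟨x, hx'⟩ := e.2 rfl
  rw [← h.generator_apply hx, h2]
  exact hasGenerator_generator hx'

theorem hasGenerator_neg {A : E →ₗ.[ℂ] E} (hA : T.generator = -A) (hx : x ∈ A.domain) :
    T.HasGenerator x (-A ⟨x, hx⟩) := by
  have hx' : x ∈ T.generator.domain := by rw [hA]; exact hx
  have e := (LinearPMap.dExt_iff.1 hA).2 (x := ⟨x, hx'⟩) (y := ⟨x, hx⟩) rfl
  have := hasGenerator_generator hx'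
  rwa [e] at this

theorem generator_eq_neg {A : E →ₗ.[ℂ] E}
    (h : ∀ x y, T.HasGenerator x y ↔ ∃ hx : x ∈ A.domain, y = -A ⟨x, hx⟩) :
    T.generator = -A := by
  refine LinearPMap.ext ?_ ?_
  · ext x
    constructor
    · rintro ⟨y, hy⟩
      exact ((h x y).1 hy).1
    · intro hx
      exact ⟨_, (h x _).2 ⟨hx, rfl⟩⟩
  · intro x hx hx'
    exact ((h x _).2 ⟨hx', rfl⟩).generator_apply hx

theorem op_sub_op_eq (T : C0Semigroup E) (x : E) {s t : ℝ≥0} (h : s ≤ t) :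
    T.op t x - T.op s x = T.op s (T.op (t - s) x - x) := by
  rw [map_sub, ← op_add_apply, add_tsub_cancel_of_le h]

section Complete

variable [CompleteSpace E]

/-- Uniform boundedness: if the norms blew up along some `s n → 0`, the orbits `T(s n) x → x` would
still be bounded for each `x`. No contractivity is assumed, because a competing semigroup with the
same generator need not be contractive a priori. -/
theorem exists_bound_near_zero (T : C0Semigroup E) :
    ∃ δ : ℝ≥0, 0 < δ ∧ ∃ C, ∀ s ≤ δ, ‖T.op s‖ ≤ C := by
  by_contra! hcon
  have h1 : ∀ n : ℕ, ∃ s : ℝ≥0, s ≤ ((n : ℝ≥0) + 1)⁻¹ ∧ (n : ℝ) < ‖T.op s‖ :=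
    fun n => hcon _ (by positivity) n
  choose s hs hn using h1
  have hs0 : Tendsto s atTop (𝓝 0) := by
    refine tendsto_of_tendsto_of_tendsto_of_le_of_le tendsto_const_nhds
      (?_ : Tendsto (fun n : ℕ => ((n : ℝ≥0) + 1)⁻¹) atTop (𝓝 0)) (fun n => zero_le) hs
    have := tendsto_one_div_add_atTop_nhds_zero_nat (𝕜 := ℝ≥0)
    simpa using this
  obtain ⟨C, hC⟩ := banach_steinhaus (g := fun n => T.op (s n)) fun x => by
    have h2 : Tendsto (fun n => T.op (s n) x) atTop (𝓝 x) := (T.tendsto_zero x).comp hs0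
    obtain ⟨C, hC⟩ := (Metric.isBounded_range_of_tendsto _ h2).exists_norm_le
    exact ⟨C, fun i => hC _ ⟨i, rfl⟩⟩
  obtain ⟨n, hn'⟩ := exists_nat_gt C
  exact absurd (hC n) (not_le.2 (hn'.trans (hn n)))

theorem exists_bound (T : C0Semigroup E) (R : ℝ≥0) : ∃ C, ∀ s ≤ R, ‖T.op s‖ ≤ C := by
  obtain ⟨δ, hδ, C, hC⟩ := T.exists_bound_near_zero
  have key : ∀ n : ℕ, ∃ C, ∀ s ≤ (n : ℝ≥0) * δ, ‖T.op s‖ ≤ C := by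
    intro n
    induction n with
    | zero =>
      refine ⟨‖T.op 0‖, fun s hs => ?_⟩
      have : s = 0 := by simpa using hs
      rw [this]
    | succ n ih =>
      obtain ⟨C', hC'⟩ := ih
      refine ⟨C * C', fun s hs => ?_⟩
      -- Truncated subtraction makes this splitting valid for `s ≤ δ` as well.
      have e : s = min s δ + (s - δ) := by
        rcases le_total s δ with h | h
        · rw [min_eq_left h, tsub_eq_zero_of_le h, add_zero]
        · rw [min_eq_right h, add_tsub_cancel_of_le h]
      have h1 : s - δ ≤ n * δ := by
        rw [tsub_le_iff_right]
        calc s ≤ _ := hs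
          _ = _ := by push_cast; ring
      have h2 := hC (min s δ) (min_le_right _ _)
      rw [e, T.op_add]
      refine (ContinuousLinearMap.opNorm_comp_le _ _).trans ?_
      exact mul_le_mul h2 (hC' _ h1) (norm_nonneg _) ((norm_nonneg _).trans h2)
  obtain ⟨n, hn⟩ := exists_nat_gt (R / δ)
  obtain ⟨C', hC'⟩ := key n
  refine ⟨C', fun s hs => hC' s (hs.trans ?_)⟩
  rw [div_lt_iff₀ hδ] at hn
  exact hn.le

/-- The difference of `T(s)x` and `T(t)x` is, up to sign, `T(min s t)(T(|s - t|)x - x)`; the first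
factor is locally bounded and the second tends to zero. -/
theorem continuous_op_apply (T : C0Semigroup E) (x : E) : Continuous fun t => T.op t x := by
  rw [continuous_iff_continuousAt]
  intro t
  obtain ⟨C, hC⟩ := T.exists_bound (t + 1)
  have h1 : Tendsto (fun s : ℝ≥0 => C * ‖T.op (nndist s t) x - x‖) (𝓝 t) (𝓝 0) := by
    have h2 : Tendsto (fun s : ℝ≥0 => nndist s t) (𝓝 t) (𝓝 0) := by
      have : Continuous fun s : ℝ≥0 => nndist s t := by fun_prop
      simpa using this.tendsto t
    have h3 := ((T.tendsto_zero x).comp h2).sub_const x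
    simpa using h3.norm.const_mul C
  rw [ContinuousAt, tendsto_iff_norm_sub_tendsto_zero]
  refine squeeze_zero' (Eventually.of_forall fun _ => norm_nonneg _) ?_ h1
  have h4 : ∀ᶠ s in 𝓝 t, s ≤ t + 1 := eventually_le_nhds (lt_add_one t)
  filter_upwards [h4] with s hs
  rcases le_total s t with h | h
  · rw [norm_sub_rev, T.op_sub_op_eq x h]
    have e : nndist s t = t - s := by
      ext; rw [coe_nndist, NNReal.dist_eq, NNReal.coe_sub h, abs_sub_comm, abs_of_nonneg]
      simpa using h
    rw [e]
    exact (T.op s).le_of_opNorm_le (hC s hs) _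
  · rw [T.op_sub_op_eq x h]
    have e : nndist s t = s - t := by
      ext; rw [coe_nndist, NNReal.dist_eq, NNReal.coe_sub h, abs_of_nonneg]
      simpa using h
    rw [e]
    exact (T.op t).le_of_opNorm_le (hC t (by simp)) _

/-- Orbits of elements of the domain of the generator are differentiable. -/
theorem HasGenerator.hasDerivWithinAt (h : T.HasGenerator x y) (t : ℝ≥0) :
    HasDerivWithinAt (fun s : ℝ => T.op s.toNNReal x) (T.op t y) (Set.Ici 0) t := by
  rw [hasDerivWithinAt_iff_tendsto_slope]
  obtain ⟨C, hC⟩ := T.exists_bound (t + 1)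
  set l := 𝓝[Set.Ici 0 \ {(t : ℝ)}] (t : ℝ)
  have hl : Tendsto (fun s : ℝ => s.toNNReal) l (𝓝 t) := by
    have := (continuous_real_toNNReal.tendsto (t : ℝ)).mono_left
      (nhdsWithin_le_nhds (s := Set.Ici 0 \ {(t : ℝ)}))
    simpa using this
  have hmem : ∀ᶠ s : ℝ in l, 0 ≤ s ∧ s ≠ t := by
    filter_upwards [self_mem_nhdsWithin] with s hs using hs
  -- The slope between `s` and `t` is `T(min s t) q(|s - t|)` on either side of `t`. Written as
  -- `T(min s t)(q - y) + T(min s t) y`, its first term vanishes by local boundedness and its second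
  -- converges by strong continuity.
  set q : ℝ≥0 → E := fun r => ((r : ℝ)⁻¹ : ℂ) • (T.op r x - x)
  have hd : Tendsto (fun s : ℝ => nndist s.toNNReal t) l (𝓝[>] 0) := by
    refine tendsto_nhdsWithin_iff.2 ⟨?_, ?_⟩
    · have := hl.nndist (tendsto_const_nhds (x := t))
      simpa using this
    · filter_upwards [hmem] with s hs
      refine pos_iff_ne_zero.2 fun h0 : nndist s.toNNReal t = 0 => hs.2 ?_
      rw [nndist_eq_zero] at h0
      rw [← h0, Real.coe_toNNReal _ hs.1]
  have hq : Tendsto (fun s : ℝ => q (nndist s.toNNReal t)) l (𝓝 y) := Tendsto.comp h hd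
  have hmin : Tendsto (fun s : ℝ => T.op (min s.toNNReal t) y) l (𝓝 (T.op t y)) := by
    have : Tendsto (fun s : ℝ => min s.toNNReal t) l (𝓝 t) := by
      simpa using hl.min (tendsto_const_nhds (x := t))
    exact ((T.continuous_op_apply y).tendsto t).comp this
  have hz : Tendsto (fun s : ℝ => T.op (min s.toNNReal t) (q (nndist s.toNNReal t) - y)) l
      (𝓝 0) := by
    have h3 : Tendsto (fun s : ℝ => C * ‖q (nndist s.toNNReal t) - y‖) l (𝓝 0) := by
      simpa using (hq.sub_const y).norm.const_mul C
    refine squeeze_zero_norm (fun s => ?_) h3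
    exact (T.op _).le_of_opNorm_le (hC _ ((min_le_right _ _).trans (by simp))) _
  have hsum := hz.add hmin
  rw [zero_add] at hsum
  refine hsum.congr' ?_
  filter_upwards [hmem] with s hs
  obtain ⟨r, rfl⟩ : ∃ r : ℝ≥0, (r : ℝ) = s := ⟨⟨s, hs.1⟩, rfl⟩
  rw [← map_add, sub_add_cancel, slope_def_module]
  simp only [Real.toNNReal_coe, q, map_smul]
  have hreal : ∀ (a : ℝ) (v : E), a • v = (a : ℂ) • v := fun a v => (Complex.coe_smul a v).symm
  rcases le_total r t with hrt | hrt
  · have e : nndist r t = t - r := by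
      ext; rw [coe_nndist, NNReal.dist_eq, NNReal.coe_sub hrt, abs_sub_comm, abs_of_nonneg]
      simpa using hrt
    rw [min_eq_left hrt, e, ← T.op_sub_op_eq x hrt, hreal, NNReal.coe_sub hrt,
      ← neg_sub (T.op r x), ← neg_sub (r : ℝ), smul_neg]
    push_cast
    rw [inv_neg, neg_smul, neg_neg]
  · have e : nndist r t = r - t := by
      ext; rw [coe_nndist, NNReal.dist_eq, NNReal.coe_sub hrt, abs_of_nonneg]
      simpa using hrt
    rw [min_eq_right hrt, e, ← T.op_sub_op_eq x hrt, hreal, NNReal.coe_sub hrt]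
    push_cast
    rfl

theorem HasGenerator.hasDerivAt (h : T.HasGenerator x y) {t : ℝ} (ht : 0 < t) :
    HasDerivAt (fun s : ℝ => T.op s.toNNReal x) (T.op t.toNNReal y) t := by
  have := h.hasDerivWithinAt t.toNNReal
  rw [Real.coe_toNNReal _ ht.le] at this
  exact this.hasDerivAt (Ici_mem_nhds ht)

/-- The orbit is restarted at time `ε`, when it already lies in the domain. The derivative is then
an orbit of a vector that does not depend on `t`, which gives its continuity. -/
theorem hasDerivAt_of_smoothing (hs : ∀ t, 0 < t → ∀ f, T.op t f ∈ T.generator.domain) (f : E)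
    {ε t : ℝ} (hε : 0 < ε) (ht : ε < t) :
    HasDerivAt (fun s : ℝ => T.op s.toNNReal f)
      (T.op (t - ε).toNNReal (T.generator ⟨_, hs ε.toNNReal (by simpa using hε) f⟩)) t := by
  have h := hasGenerator_generator (hs ε.toNNReal (by simpa using hε) f)
  have h1 := HasDerivAt.comp_sub_const t ε (h.hasDerivAt (sub_pos.2 ht))
  refine h1.congr_of_eventuallyEq ?_
  filter_upwards [lt_mem_nhds ht] with s hs
  rw [← T.op_add_apply, ← Real.toNNReal_add (by linarith) hε.le, sub_add_cancel]

theorem isCauchySolution_orbit {A : E →ₗ.[ℂ] E} (hA : T.generator = -A)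
    (hs : ∀ t, 0 < t → ∀ f, T.op t f ∈ A.domain) (f : E) :
    IsCauchySolution A f fun t => T.op t.toNNReal f := by
  have hs' : ∀ t, 0 < t → ∀ f, T.op t f ∈ T.generator.domain := by rw [hA]; exact hs
  have hd := fun (ε t : ℝ) (hε : 0 < ε) (ht : ε < t) => hasDerivAt_of_smoothing hs' f hε ht
  refine ⟨((T.continuous_op_apply f).comp continuous_real_toNNReal).continuousOn, ?_,
    fun t ht => hs _ (by simpa using ht) f, ?_, by simp [T.op_zero_apply]⟩
  · rw [show (1 : WithTop ℕ∞) = 0 + 1 by simp, contDiffOn_succ_iff_deriv_of_isOpen isOpen_Ioi]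
    refine ⟨fun t ht => ?_, by simp, ?_⟩
    · exact (hd (t / 2) t (half_pos ht) (half_lt_self ht)).differentiableAt.differentiableWithinAt
    · rw [contDiffOn_zero]
      intro t ht
      refine ContinuousAt.continuousWithinAt ?_
      have ht' : 0 < t / 2 := half_pos ht
      set y := T.generator ⟨_, hs' (t / 2).toNNReal (by simpa using ht') f⟩
      have hc : Continuous fun s : ℝ => T.op (s - t / 2).toNNReal y :=
        (T.continuous_op_apply y).comp (continuous_real_toNNReal.comp (by fun_prop))
      refine hc.continuousAt.congr ?_
      filter_upwards [lt_mem_nhds (half_lt_self ht)] with s hs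
      exact (hd (t / 2) s ht' hs).deriv.symm
  · intro t ht
    have h2 := (hd (t / 2) t (half_pos ht) (half_lt_self ht))
    have hmem := hs t.toNNReal (by simpa using ht) f
    have h3 := hasGenerator_neg hA hmem
    -- The derivative is known so far only through the restart at `t / 2`. Restarting at `t` itself
    -- gives the right derivative `-A u(t)`, and uniqueness of one-sided derivatives identifies the
    -- two.
    have h4 := h3.hasDerivWithinAt 0
    have h5 : HasDerivWithinAt (fun s : ℝ => T.op s.toNNReal f) (-A ⟨_, hmem⟩) (Set.Ici t) t := by
      have h6 : HasDerivWithinAt (fun s : ℝ => T.op s.toNNReal (T.op t.toNNReal f))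
          (-A ⟨_, hmem⟩) (Set.Ici 0) (t - t) := by
        simpa [T.op_zero_apply] using h4
      have h7 := HasDerivWithinAt.scomp (h := fun s : ℝ => s - t) t h6
        ((hasDerivAt_id' t).sub_const t).hasDerivWithinAt
        (s := Set.Ici t) (fun s hs => by simpa using hs)
      rw [one_smul] at h7
      refine h7.congr (fun s hs => ?_) ?_
      · have hs' : t ≤ s := hs
        simp only [Function.comp]
        rw [← T.op_add_apply, ← Real.toNNReal_add (by linarith) ht.le, sub_add_cancel]
      · simp [T.op_zero_apply]
    have h8 := (uniqueDiffWithinAt_Ici t).eq_deriv _ h2.hasDerivWithinAt h5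
    rw [h2.deriv, h8, neg_add_cancel]

end Complete

end Banach

/-! ### Dissipativity and uniqueness for contraction semigroups. -/

section Hilbert

variable {E : Type*} [NormedAddCommGroup E] [InnerProductSpace ℂ E] {T T' : C0Semigroup E} {x y : E}

/-- Since `Re ⟨x, T(t)x⟩ ≤ ‖x‖²`, every difference quotient has nonpositive real inner product with
`x`. -/
theorem HasGenerator.re_inner_nonpos (hT : ∀ t x, ‖T.op t x‖ ≤ ‖x‖) (h : T.HasGenerator x y) :
    (inner ℂ x y).re ≤ 0 := by
  have h1 : Tendsto (fun t : ℝ≥0 => (inner ℂ x (((t : ℝ)⁻¹ : ℂ) • (T.op t x - x))).re)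
      (𝓝[>] 0) (𝓝 (inner ℂ x y).re) :=
    (Complex.continuous_re.tendsto _).comp (tendsto_const_nhds.inner h)
  refine le_of_tendsto h1 (Eventually.of_forall fun t => ?_)
  rw [inner_smul_right, ← Complex.ofReal_inv, Complex.re_ofReal_mul, inner_sub_right,
    Complex.sub_re]
  refine mul_nonpos_of_nonneg_of_nonpos (by positivity) ?_
  have h2 : (inner ℂ x (T.op t x)).re ≤ ‖x‖ * ‖x‖ :=
    (Complex.re_le_norm _).trans ((norm_inner_le_norm _ _).trans
      (mul_le_mul_of_nonneg_left (hT t x) (norm_nonneg _)))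
  have h3 : (inner ℂ x x).re = ‖x‖ * ‖x‖ := by
    rw [inner_self_eq_norm_sq_to_K]; norm_cast; exact sq _
  linarith

/-- The energy `‖w‖²` has right derivative `2 Re ⟨w, w'⟩ ≤ 0`. A Cauchy solution need not be
differentiable at `0`, so `‖w t‖ ≤ ‖w ε‖` is proved for `ε > 0` and continuity takes `ε → 0`. -/
theorem eq_zero_of_re_inner_deriv_nonpos {w w' : ℝ → E} (hc : ContinuousOn w (Set.Ici 0))
    (h0 : w 0 = 0) (hd : ∀ t, 0 < t → HasDerivWithinAt w (w' t) (Set.Ici t) t)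
    (hw : ∀ t, 0 < t → (inner ℂ (w t) (w' t)).re ≤ 0) {t : ℝ} (ht : 0 ≤ t) : w t = 0 := by
  rcases ht.eq_or_lt with rfl | ht
  · exact h0
  let _ : InnerProductSpace ℝ E := InnerProductSpace.complexToReal
  have key : ∀ ε ∈ Set.Ioo 0 t, ‖w t‖ ^ 2 ≤ ‖w ε‖ ^ 2 := by
    intro ε hε
    refine image_le_of_deriv_right_le_deriv_boundary (f := fun s => ‖w s‖ ^ 2)
      (f' := fun s => 2 * inner ℝ (w s) (w' s)) (a := ε) (b := t) (B := fun _ => ‖w ε‖ ^ 2)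
      (B' := fun _ => 0) ?_ ?_ le_rfl continuousOn_const ?_ ?_ ⟨hε.2.le, le_rfl⟩
    · exact ((hc.mono fun s hs => hε.1.le.trans hs.1).norm).pow 2
    · exact fun s hs => (hd s (hε.1.trans_le hs.1)).norm_sq
    · exact fun s _ => hasDerivWithinAt_const _ _ _
    · intro s hs
      have := hw s (hε.1.trans_le hs.1)
      rw [real_inner_eq_re_inner ℂ]
      exact mul_nonpos_of_nonneg_of_nonpos zero_le_two this
  have hlim : Tendsto (fun ε => ‖w ε‖ ^ 2) (𝓝[>] 0) (𝓝 0) := by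
    have h1 : Tendsto w (𝓝[>] 0) (𝓝 (w 0)) :=
      (hc 0 (by simp)).mono_left (nhdsWithin_mono _ Set.Ioi_subset_Ici_self)
    have h2 := h1.norm.pow 2
    simpa [h0] using h2
  have h3 : ‖w t‖ ^ 2 ≤ 0 := by
    refine ge_of_tendsto hlim ?_
    filter_upwards [Ioo_mem_nhdsGT ht] with ε hε using key ε hε
  have h4 : ‖w t‖ = 0 := by
    have := norm_nonneg (w t)
    nlinarith
  exact norm_eq_zero.1 h4

theorem isCauchySolution_unique {A : E →ₗ.[ℂ] E} (hT : ∀ t x, ‖T.op t x‖ ≤ ‖x‖)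
    (hA : T.generator = -A) {f : E} {u v : ℝ → E} (hu : IsCauchySolution A f u)
    (hv : IsCauchySolution A f v) : Set.EqOn v u (Set.Ici 0) := by
  intro t ht
  refine sub_eq_zero.1 (eq_zero_of_re_inner_deriv_nonpos (w := fun t => v t - u t)
    (w' := fun t => deriv v t - deriv u t) (hv.continuousOn.sub hu.continuousOn) ?_ ?_ ?_ ht)
  · simp [hu.initial, hv.initial]
  · intro s hs
    have h : ∀ {w : ℝ → E}, IsCauchySolution A f w → HasDerivAt w (deriv w s) s := fun hw =>
      ((hw.contDiffOn.differentiableOn one_ne_zero s hs).differentiableAt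
        (Ioi_mem_nhds hs)).hasDerivAt
    exact ((h hv).sub (h hu)).hasDerivWithinAt
  · intro s hs
    have h : ∀ {w : ℝ → E}, IsCauchySolution A f w → T.HasGenerator (w s) (deriv w s) := by
      intro w hw
      have := hasGenerator_neg hA (hw.mem_domain s hs)
      rwa [← eq_neg_of_add_eq_zero_left (hw.equation s hs)] at this
    exact ((h hv).sub (h hu)).re_inner_nonpos hT

/-- Only `T` has to be contractive: the difference of the two orbits of a domain vector solves the
equation for the common generator, which is dissipative because of `T`. Density and boundedness of
the operators do the rest. -/
theorem eq_of_generator_eq [CompleteSpace E] (hT : ∀ t x, ‖T.op t x‖ ≤ ‖x‖)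
    (hd : Dense (T.generator.domain : Set E)) (h : T'.generator = T.generator) : T' = T := by
  refine ext_op fun t => ?_
  have key : Set.EqOn (T'.op t) (T.op t) (T.generator.domain : Set E) := by
    rintro x ⟨y, hy⟩
    have hy' : T'.HasGenerator x y := hy.of_generator_eq h.symm
    have h1 := eq_zero_of_re_inner_deriv_nonpos
      (w := fun s : ℝ => T'.op s.toNNReal x - T.op s.toNNReal x)
      (w' := fun s : ℝ => T'.op s.toNNReal y - T.op s.toNNReal y) ?_ ?_ ?_ ?_ t.2
    · have h2 := sub_eq_zero.1 h1
      simpa using h2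
    · exact (((T'.continuous_op_apply x).comp continuous_real_toNNReal).sub
        ((T.continuous_op_apply x).comp continuous_real_toNNReal)).continuousOn
    · simp [op_zero_apply]
    · exact fun s hs => ((hy'.hasDerivAt hs).sub (hy.hasDerivAt hs)).hasDerivWithinAt
    · exact fun s _ => (((hy'.op _).of_generator_eq h).sub (hy.op _)).re_inner_nonpos hT
  exact congrFun ((T'.op t).continuous.ext_on hd (T.op t).continuous key)

theorem dense_of_smoothing {D : Set E} (hs : ∀ t, 0 < t → ∀ f, T.op t f ∈ D) : Dense D := by
  intro f
  refine mem_closure_of_tendsto ((T.tendsto_zero f).mono_left nhdsWithin_le_nhds) (b := 𝓝[>] 0) ?_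
  filter_upwards [self_mem_nhdsWithin] with t ht using hs t ht f

end Hilbert

end C0Semigroup

theorem norm_exp_neg_mul_le_one {X : Type*} {m : X → ℝ} (h0 : ∀ x, 0 ≤ m x) {t : ℝ}
    (ht : 0 ≤ t) (x : X) :
    ‖(Real.exp (-t * m x) : ℂ)‖ ≤ 1 := by
  rw [Complex.norm_real, Real.norm_of_nonneg (Real.exp_pos _).le, Real.exp_le_one_iff]
  have := mul_nonneg ht (h0 x)
  linarith

/-! ### Multiplication semigroups on `L²` and their generators. -/

section Multiplication

variable {X : Type*} [MeasurableSpace X] {μ : Measure X}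

theorem memLp_bounded_mul {b : X → ℂ} (hb : Measurable b) {C : ℝ} (hC : ∀ x, ‖b x‖ ≤ C)
    {g : X → ℂ} (hg : MemLp g 2 μ) : MemLp (fun x => b x * g x) 2 μ := by
  refine (hg.norm.const_mul C).of_le (hb.aestronglyMeasurable.mul hg.1)
    (Eventually.of_forall fun x => ?_)
  have hC0 : 0 ≤ C := (norm_nonneg _).trans (hC x)
  rw [norm_mul, Real.norm_of_nonneg (by positivity)]
  exact mul_le_mul_of_nonneg_right (hC x) (norm_nonneg _)

/-- Multiplication by a measurable function of absolute value at most one on `L²`. -/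
def boundedMul (μ : Measure X) (b : X → ℂ) (hb : Measurable b) (h1 : ∀ x, ‖b x‖ ≤ 1) :
    Lp ℂ 2 μ →L[ℂ] Lp ℂ 2 μ :=
  LinearMap.mkContinuous
    { toFun := fun g => (memLp_bounded_mul hb h1 (Lp.memLp g)).toLp _
      map_add' := fun g h => by
        rw [← MemLp.toLp_add]
        refine MemLp.toLp_congr _ _ ?_
        filter_upwards [Lp.coeFn_add g h] with x e
        rw [e, Pi.add_apply, Pi.add_apply, mul_add]
      map_smul' := fun c g => by
        rw [RingHom.id_apply, ← MemLp.toLp_const_smul]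
        refine MemLp.toLp_congr _ _ ?_
        filter_upwards [Lp.coeFn_smul c g] with x e
        rw [e, Pi.smul_apply, Pi.smul_apply, mul_smul_comm] } 1
    fun g => by
      rw [one_mul]
      refine Lp.norm_le_norm_of_ae_le ?_
      filter_upwards [MemLp.coeFn_toLp (memLp_bounded_mul hb h1 (Lp.memLp g))] with x e
      simp only [LinearMap.coe_mk, AddHom.coe_mk]
      rw [e, norm_mul]
      exact mul_le_of_le_one_left (norm_nonneg _) (h1 x)

theorem coeFn_boundedMul {b : X → ℂ} (hb : Measurable b) (h1 : ∀ x, ‖b x‖ ≤ 1) (g : Lp ℂ 2 μ) :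
    boundedMul μ b hb h1 g =ᵐ[μ] fun x => b x * g x :=
  MemLp.coeFn_toLp (memLp_bounded_mul hb h1 (Lp.memLp g))

theorem norm_boundedMul_le {b : X → ℂ} (hb : Measurable b) (h1 : ∀ x, ‖b x‖ ≤ 1) (g : Lp ℂ 2 μ) :
    ‖boundedMul μ b hb h1 g‖ ≤ ‖g‖ := by
  refine Lp.norm_le_norm_of_ae_le ?_
  filter_upwards [coeFn_boundedMul hb h1 g] with x e
  rw [e, norm_mul]
  exact mul_le_of_le_one_left (norm_nonneg _) (h1 x)

/-- Dominated convergence in `L²`. -/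
theorem tendsto_L2_of_dominated {ι : Type*} {l : Filter ι} [l.IsCountablyGenerated]
    {F : ι → Lp ℂ 2 μ} {f : Lp ℂ 2 μ} {c : ι → X → ℂ} (G : X → ℝ) (hF : ∀ i, F i =ᵐ[μ] c i)
    (hG : MemLp G 2 μ) (bound : ∀ᶠ i in l, ∀ᵐ x ∂μ, ‖c i x - f x‖ ≤ G x)
    (lim : ∀ᵐ x ∂μ, Tendsto (fun i => c i x) l (𝓝 (f x))) : Tendsto F l (𝓝 f) := by
  rw [Lp.tendsto_Lp_iff_tendsto_eLpNorm']
  have h2 : Tendsto (fun i => ∫⁻ x, ‖c i x - f x‖ₑ ^ (2 : ℝ) ∂μ) l (𝓝 (∫⁻ _, 0 ∂μ)) := by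
    refine tendsto_lintegral_filter_of_dominated_convergence' (fun x => ‖G x‖ₑ ^ (2 : ℝ))
      (Eventually.of_forall fun i => ?_) ?_ ?_ ?_
    · have : AEStronglyMeasurable (c i) μ := (Lp.aestronglyMeasurable (F i)).congr (hF i)
      exact (this.sub (Lp.aestronglyMeasurable f)).enorm.pow_const _
    · filter_upwards [bound] with i hi
      filter_upwards [hi] with x hx
      gcongr
      exact enorm_le_iff_norm_le.2 (hx.trans (le_abs_self _))
    · have := hG.eLpNorm_lt_top
      rw [eLpNorm_lt_top_iff_lintegral_rpow_enorm_lt_top two_ne_zero ENNReal.ofNat_ne_top] at this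
      simpa using this.ne
    · filter_upwards [lim] with x hx
      have h3 : Tendsto (fun i => ‖c i x - f x‖ₑ) l (𝓝 0) := by
        have := (hx.sub_const (f x)).enorm
        simpa using this
      have := (ENNReal.continuous_rpow_const (y := 2)).tendsto 0 |>.comp h3
      simpa [Function.comp_def] using this
  rw [lintegral_zero] at h2
  have h3 := (ENNReal.continuous_rpow_const (y := 1 / 2)).tendsto 0 |>.comp h2
  simp only [Function.comp_def, one_div] at h3
  rw [ENNReal.zero_rpow_of_pos (by norm_num)] at h3
  refine h3.congr fun i => ?_
  rw [eLpNorm_eq_lintegral_rpow_enorm_toReal two_ne_zero ENNReal.ofNat_ne_top]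
  simp only [ENNReal.toReal_ofNat, one_div]
  congr 1
  refine lintegral_congr_ae ?_
  filter_upwards [hF i] with x hx
  rw [Pi.sub_apply, hx]

variable {m : X → ℝ}

theorem measurable_exp_neg_mul (hm : Measurable m) (t : ℝ) :
    Measurable fun x => (Real.exp (-t * m x) : ℂ) := by fun_prop

/-- The semigroup of multiplication by `e^{-t m}` on `L²`, where `m ≥ 0`. -/
def mulSemigroup (μ : Measure X) (m : X → ℝ) (hm : Measurable m) (h0 : ∀ x, 0 ≤ m x) :
    C0Semigroup (Lp ℂ 2 μ) where
  op t := boundedMul μ (fun x => (Real.exp (-t * m x) : ℂ)) (measurable_exp_neg_mul hm t)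
    (norm_exp_neg_mul_le_one h0 t.2)
  op_zero := by
    ext1 g
    refine Lp.ext ?_
    filter_upwards [coeFn_boundedMul (measurable_exp_neg_mul hm (0 : ℝ≥0))
      (norm_exp_neg_mul_le_one h0 (0 : ℝ≥0).2) g] with x hx
    rw [hx]
    simp
  op_add s t := by
    ext1 g
    refine Lp.ext ?_
    filter_upwards [coeFn_boundedMul (measurable_exp_neg_mul hm (s + t : ℝ≥0))
      (norm_exp_neg_mul_le_one h0 (s + t : ℝ≥0).2) g,
      coeFn_boundedMul (measurable_exp_neg_mul hm t) (norm_exp_neg_mul_le_one h0 t.2) g,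
      coeFn_boundedMul (measurable_exp_neg_mul hm s) (norm_exp_neg_mul_le_one h0 s.2)
        (boundedMul μ (fun x => (Real.exp (-t * m x) : ℂ)) (measurable_exp_neg_mul hm t)
          (norm_exp_neg_mul_le_one h0 t.2) g)] with x h1 h2 h3
    rw [h1, ContinuousLinearMap.comp_apply, h3, h2, ← mul_assoc, ← Complex.ofReal_mul,
      ← Real.exp_add]
    congr 3
    push_cast
    ring
  tendsto_zero g := by
    refine tendsto_L2_of_dominated (fun x => 2 * ‖g x‖) (fun t => coeFn_boundedMul
      (measurable_exp_neg_mul hm t) (norm_exp_neg_mul_le_one h0 t.2) g)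
      ((Lp.memLp g).norm.const_mul 2) (Eventually.of_forall fun t => Eventually.of_forall
        fun x => ?_) (Eventually.of_forall fun x => ?_)
    · refine (norm_sub_le _ _).trans ?_
      rw [norm_mul, two_mul]
      gcongr
      exact mul_le_of_le_one_left (norm_nonneg _) (norm_exp_neg_mul_le_one h0 t.2 x)
    · have h1 : Continuous fun t : ℝ≥0 => (Real.exp (-t * m x) : ℂ) * g x := by fun_prop
      simpa using h1.tendsto 0

theorem coeFn_mulSemigroup (hm : Measurable m) (h0 : ∀ x, 0 ≤ m x) (t : ℝ≥0) (g : Lp ℂ 2 μ) :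
    (mulSemigroup μ m hm h0).op t g =ᵐ[μ] fun x => (Real.exp (-t * m x) : ℂ) * g x :=
  coeFn_boundedMul (measurable_exp_neg_mul hm t) (norm_exp_neg_mul_le_one h0 t.2) g

theorem norm_mulSemigroup_le (hm : Measurable m) (h0 : ∀ x, 0 ≤ m x) (t : ℝ≥0) (g : Lp ℂ 2 μ) :
    ‖(mulSemigroup μ m hm h0).op t g‖ ≤ ‖g‖ :=
  norm_boundedMul_le (measurable_exp_neg_mul hm t) (norm_exp_neg_mul_le_one h0 t.2) g

/-- This is the smoothing property: `tm + 1 ≤ e^{tm}` gives `m e^{-tm} ≤ t⁻¹`. -/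
theorem memLp_mul_mulSemigroup (hm : Measurable m) (h0 : ∀ x, 0 ≤ m x) {t : ℝ≥0} (ht : 0 < t)
    (g : Lp ℂ 2 μ) :
    MemLp (fun x => (m x : ℂ) * (mulSemigroup μ m hm h0).op t g x) 2 μ := by
  have hb : Measurable fun x => ((m x * Real.exp (-t * m x) : ℝ) : ℂ) := by fun_prop
  have ht' : (0 : ℝ) < t := ht
  refine (memLp_congr_ae ?_).2 (memLp_bounded_mul hb (C := (t : ℝ)⁻¹) (fun x => ?_) (Lp.memLp g))
  · filter_upwards [coeFn_mulSemigroup hm h0 t g] with x hx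
    rw [hx]; push_cast; ring
  · rw [Complex.norm_real, Real.norm_of_nonneg (mul_nonneg (h0 x) (Real.exp_pos _).le),
      neg_mul, Real.exp_neg, mul_inv_le_iff₀ (Real.exp_pos _), inv_mul_eq_div, le_div_iff₀ ht']
    have := Real.add_one_le_exp ((t : ℝ) * m x)
    linarith

theorem tendsto_exp_slope (a : ℝ) (z : ℂ) :
    Tendsto (fun t : ℝ≥0 => ((t : ℝ)⁻¹ : ℂ) * ((Real.exp (-t * a) : ℂ) * z - z)) (𝓝[>] 0)
      (𝓝 (-(a * z))) := by
  have h1 : HasDerivAt (fun t : ℝ => Real.exp (-t * a)) (-a) 0 := by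
    have := ((hasDerivAt_id' (0 : ℝ)).neg.mul_const a).exp
    simpa using this
  have h2 := h1.tendsto_slope_zero_right
  have h3 : Tendsto (fun t : ℝ≥0 => (t : ℝ)) (𝓝[>] 0) (𝓝[>] 0) :=
    tendsto_nhdsWithin_iff.2 ⟨(NNReal.continuous_coe.tendsto 0).mono_left nhdsWithin_le_nhds,
      eventually_mem_nhdsWithin⟩
  have h4 := ((Complex.continuous_ofReal.tendsto _).comp (h2.comp h3)).mul_const z
  have h5 : ((-a : ℝ) : ℂ) * z = -(a * z) := by push_cast; ring
  rw [h5] at h4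
  refine h4.congr fun t => ?_
  simp
  ring

theorem abs_exp_slope_le {a t : ℝ} (ha : 0 ≤ a) (ht : 0 < t) :
    |t⁻¹ * (Real.exp (-t * a) - 1)| ≤ a := by
  have h1 : Real.exp (-t * a) ≤ 1 := Real.exp_le_one_iff.2 (by nlinarith)
  have h2 := Real.add_one_le_exp (-t * a)
  rw [abs_mul, abs_of_pos (inv_pos.2 ht), abs_of_nonpos (by linarith), inv_mul_le_iff₀ ht]
  linarith

/-- The domain condition is implicit: an `L²` function `y` equal to `-m g` exists only if `m g` is
in `L²`. From left to right, `t` is restricted to the sequence `1/(n+1)`, so that a subsequence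
converges a.e. and only countably many null sets occur. From right to left, the difference quotients
are dominated by `m |g| = |y|`. -/
theorem hasGenerator_mulSemigroup_iff (hm : Measurable m) (h0 : ∀ x, 0 ≤ m x) (g y : Lp ℂ 2 μ) :
    (mulSemigroup μ m hm h0).HasGenerator g y ↔ y =ᵐ[μ] fun x => -(m x * g x) := by
  set T := mulSemigroup μ m hm h0
  have hc : ∀ t : ℝ≥0, (((t : ℝ)⁻¹ : ℂ) • (T.op t g - g) : Lp ℂ 2 μ) =ᵐ[μ]
      fun x => ((t : ℝ)⁻¹ : ℂ) * ((Real.exp (-t * m x) : ℂ) * g x - g x) := by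
    intro t
    filter_upwards [Lp.coeFn_smul ((t : ℝ)⁻¹ : ℂ) (T.op t g - g), Lp.coeFn_sub (T.op t g) g,
      coeFn_mulSemigroup hm h0 t g] with x h1 h2 h3
    rw [h1, Pi.smul_apply, h2, Pi.sub_apply, h3, smul_eq_mul]
  constructor
  · intro h
    have hs : Tendsto (fun n : ℕ => ((n : ℝ≥0) + 1)⁻¹) atTop (𝓝[>] 0) := by
      refine tendsto_nhdsWithin_iff.2 ⟨?_, Eventually.of_forall fun n => ?_⟩
      · simpa using tendsto_one_div_add_atTop_nhds_zero_nat (𝕜 := ℝ≥0)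
      · simp only [Set.mem_Ioi]; positivity
    obtain ⟨ns, hns, hae⟩ := (tendstoInMeasure_of_tendsto_Lp (h.comp hs)).exists_seq_tendsto_ae
    filter_upwards [hae, ae_all_iff.2 fun n : ℕ => hc ((n : ℝ≥0) + 1)⁻¹] with x h1 h2
    refine tendsto_nhds_unique h1 ?_
    have h3 := (tendsto_exp_slope (m x) (g x)).comp (hs.comp hns.tendsto_atTop)
    refine h3.congr fun n => ?_
    exact (h2 (ns n)).symm
  · intro h
    refine tendsto_L2_of_dominated (fun x => 2 * ‖y x‖) hc ((Lp.memLp y).norm.const_mul 2) ?_ ?_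
    · filter_upwards [self_mem_nhdsWithin] with t ht
      filter_upwards [h] with x hx
      refine (norm_sub_le _ _).trans ?_
      rw [two_mul]
      gcongr
      have e : ((t : ℝ)⁻¹ : ℂ) * ((Real.exp (-t * m x) : ℂ) * g x - g x)
          = (((t : ℝ)⁻¹ * (Real.exp (-t * m x) - 1) : ℝ) : ℂ) * g x := by push_cast; ring
      rw [hx, e, norm_neg, norm_mul, norm_mul, Complex.norm_real, Complex.norm_real,
        Real.norm_eq_abs, Real.norm_of_nonneg (h0 x)]
      gcongr
      exact abs_exp_slope_le (h0 x) (by exact_mod_cast ht)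
    · filter_upwards [h] with x hx
      rw [hx]
      exact tendsto_exp_slope (m x) (g x)

end Multiplication

variable {S : Finset Nat.Primes}

/-! ### Fourier integrals on `ℚ_S` -/

theorem norm_char (x : QS S) : ‖char x‖ = 1 := by
  rw [char, norm_prod]
  refine Finset.prod_eq_one fun p _ => ?_
  rw [padicChar, show 2 * (Real.pi : ℂ) * Complex.I * (fracPart (x p) : ℂ)
    = ((2 * Real.pi * fracPart (x p) : ℝ) : ℂ) * Complex.I by push_cast; ring,
    Complex.norm_exp_ofReal_mul_I]

theorem char_neg (x : QS S) : char (-x) = conj (char x) := by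
  have h : char x * char (-x) = 1 := by
    rw [← char_add, add_neg_cancel, char_eq_one (by simp)]
  rw [← Complex.inv_eq_conj (norm_char x)]
  exact eq_inv_of_mul_eq_one_right h

theorem continuous_char : Continuous (char : QS S → ℂ) := isLocallyConstant_char.continuous

theorem norm_mul_char (z : ℂ) (x : QS S) : ‖z * char x‖ = ‖z‖ := by
  rw [norm_mul, norm_char, mul_one]

theorem aestronglyMeasurable_mul_char {f : QS S → ℂ} (hf : AEStronglyMeasurable f (haar S))
    (ξ : QS S) : AEStronglyMeasurable (fun x => f x * char (ξ * x)) (haar S) :=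
  hf.mul (continuous_char.comp (continuous_const.mul continuous_id)).aestronglyMeasurable

theorem integrable_mul_char {f : QS S → ℂ} (hf : Integrable f (haar S)) (ξ : QS S) :
    Integrable (fun x => f x * char (ξ * x)) (haar S) :=
  hf.mono (aestronglyMeasurable_mul_char hf.1 ξ)
    (Eventually.of_forall fun _ => (norm_mul_char _ _).le)

theorem memLp_mul_char {f : QS S → ℂ} {p : ℝ≥0∞} (hf : MemLp f p (haar S)) (ξ : QS S) :
    MemLp (fun x => f x * char (ξ * x)) p (haar S) :=
  hf.of_le (aestronglyMeasurable_mul_char hf.1 ξ)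
    (Eventually.of_forall fun _ => (norm_mul_char _ _).le)

theorem continuous_fourier {f : QS S → ℂ} (hf : Integrable f (haar S)) :
    Continuous (fourier f) := by
  refine continuous_of_dominated (bound := fun x => ‖f x‖)
    (fun ξ => aestronglyMeasurable_mul_char hf.1 ξ)
    (fun ξ => Eventually.of_forall fun _ => (norm_mul_char _ _).le) hf.norm
    (Eventually.of_forall fun x => ?_)
  exact continuous_const.mul (continuous_char.comp (continuous_id.mul continuous_const))

/-- The multiplication formula `∫ f̂ g = ∫ f ĝ`. -/
theorem integral_fourier_mul {f g : QS S → ℂ} (hf : Integrable f (haar S))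
    (hg : Integrable g (haar S)) :
    ∫ ξ, fourier f ξ * g ξ ∂(haar S) = ∫ x, f x * fourier g x ∂(haar S) := by
  have h1 : Integrable (fun z : QS S × QS S => f z.2 * char (z.1 * z.2) * g z.1)
      ((haar S).prod (haar S)) := by
    refine (hg.mul_prod hf).mono ?_ (Eventually.of_forall fun z => ?_)
    · exact ((hf.1.comp_snd).mul (continuous_char.comp
        (continuous_fst.mul continuous_snd)).aestronglyMeasurable).mul hg.1.comp_fst
    · rw [norm_mul, norm_mul_char, norm_mul, mul_comm]
  have h2 : ∀ ξ, fourier f ξ * g ξ = ∫ x, f x * char (ξ * x) * g ξ ∂(haar S) := fun ξ =>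
    (integral_mul_const _ _).symm
  have h3 : ∀ x, f x * fourier g x = ∫ ξ, f x * char (ξ * x) * g ξ ∂(haar S) := fun x => by
    rw [fourier, ← integral_const_mul]
    refine integral_congr_ae (Eventually.of_forall fun ξ => ?_)
    simp only
    rw [mul_comm x ξ]
    ring
  simp only [h2, h3]
  exact integral_integral_swap h1

theorem fourier_comp_neg (f : QS S → ℂ) (ξ : QS S) :
    fourier (fun x => f (-x)) ξ = fourierInv f ξ := by
  rw [fourier, fourierInv, ← integral_neg_eq_self]
  simp

theorem fourier_conj (f : QS S → ℂ) (ξ : QS S) :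
    fourier (fun x => conj (f x)) ξ = conj (fourierInv f ξ) := by
  rw [fourier, fourierInv, ← integral_conj]
  simp [char_neg]

theorem fourierInv_conj (f : QS S → ℂ) (ξ : QS S) :
    fourierInv (fun x => conj (f x)) ξ = conj (fourier f ξ) := by
  rw [fourier, fourierInv, ← integral_conj]
  simp [char_neg]

theorem integral_fourierInv_mul {f g : QS S → ℂ} (hf : Integrable f (haar S))
    (hg : Integrable g (haar S)) :
    ∫ ξ, fourierInv f ξ * g ξ ∂(haar S) = ∫ x, f x * fourierInv g x ∂(haar S) := by
  rw [← integral_neg_eq_self]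
  simp only [fourierInv_eq f, neg_neg]
  rw [integral_fourier_mul hf hg.comp_neg]
  simp only [fourier_comp_neg]

/-! ### Scaling and Fourier inversion for test functions -/

theorem mem_ZS {x : QS S} : x ∈ ZS S ↔ ∀ p, ‖x p‖ ≤ 1 := Iff.rfl

theorem norm_le_one_of_mem_ZS {x : QS S} (hx : x ∈ ZS S) : ‖x‖ ≤ 1 :=
  (pi_norm_le_iff_of_nonneg zero_le_one).2 hx

theorem mul_mem_ZS {x y : QS S} (hx : x ∈ ZS S) (hy : y ∈ ZS S) : x * y ∈ ZS S := fun p => by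
  rw [Pi.mul_apply, norm_mul]
  exact mul_le_one₀ (hx p) (norm_nonneg _) (hy p)

theorem add_mem_ZS {x y : QS S} (hx : x ∈ ZS S) (hy : y ∈ ZS S) : x + y ∈ ZS S := fun p =>
  (Padic.nonarchimedean _ _).trans (max_le (hx p) (hy p))

theorem neg_mem_ZS {x : QS S} (hx : x ∈ ZS S) : -x ∈ ZS S := fun p => by
  rw [Pi.neg_apply, norm_neg]; exact hx p

theorem haar_ZS (S : Finset Nat.Primes) : haar S (ZS S : Set (QS S)) = 1 :=
  Measure.addHaarMeasure_self

theorem isClosed_ZS (S : Finset Nat.Primes) : IsClosed (ZS S : Set (QS S)) :=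
  (ZS S).isCompact.isClosed

/-- Multiplication by a unit of `ℚ_S`. -/
def unitMul (u : (QS S)ˣ) : QS S ≃ₜ QS S where
  toFun x := (u : QS S) * x
  invFun x := ((u⁻¹ : (QS S)ˣ) : QS S) * x
  left_inv x := by simp
  right_inv x := by simp
  continuous_toFun := continuous_const.mul continuous_id
  continuous_invFun := continuous_const.mul continuous_id

/-- Uniqueness of Haar measure. The modulus is never computed: it cancels in Fourier inversion, and
a covering bounds it in the volume estimate. -/
theorem map_mul_haar (u : (QS S)ˣ) :
    ∃ c : ℝ≥0, Measure.map (unitMul u) (haar S) = c • haar S := by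
  let e : QS S ≃+ QS S := AddEquiv.mk (unitMul u).toEquiv fun x y => mul_add _ x y
  have : (Measure.map (unitMul u) (haar S)).IsAddHaarMeasure :=
    e.isAddHaarMeasure_map (haar S) (unitMul u).continuous (unitMul u).symm.continuous
  exact ⟨_, Measure.isAddLeftInvariant_eq_smul (Measure.map (unitMul u) (haar S)) (haar S)⟩

theorem integral_mul_left_eq (u : (QS S)ˣ) :
    ∃ c : ℂ, ∀ f : QS S → ℂ, ∫ x, f ((u : QS S) * x) ∂(haar S) = c * ∫ x, f x ∂(haar S) := by
  obtain ⟨c, hc⟩ := map_mul_haar u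
  refine ⟨(c : ℝ), fun f => ?_⟩
  have h := (unitMul u).measurableEmbedding.integral_map (μ := haar S) f
  rw [hc, integral_smul_nnreal_measure, NNReal.smul_def, Complex.real_smul] at h
  exact h.symm

theorem integral_indicator_ZS (S : Finset Nat.Primes) :
    ∫ x, (ZS S : Set (QS S)).indicator (1 : QS S → ℂ) x ∂(haar S) = 1 := by
  rw [integral_indicator (isClosed_ZS S).measurableSet]
  simp [measureReal_def, haar_ZS]

/-- For `ξ` in `ℤ_S` the character is trivial on `ℤ_S`. Otherwise some `y` in `ℤ_S` has `χ(ξy) ≠ 1`,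
and translating by `y` multiplies the integral by this number, forcing it to vanish. -/
theorem fourier_indicator_ZS (ξ : QS S) :
    fourier ((ZS S : Set (QS S)).indicator 1) ξ = (ZS S : Set (QS S)).indicator 1 ξ := by
  classical
  by_cases hξ : ξ ∈ ZS S
  · rw [Set.indicator_of_mem (by exact hξ)]
    have : ∀ x, (ZS S : Set (QS S)).indicator (1 : QS S → ℂ) x * char (ξ * x)
        = (ZS S : Set (QS S)).indicator 1 x := by
      intro x
      by_cases hx : x ∈ (ZS S : Set (QS S))
      · rw [char_eq_one (norm_le_one_of_mem_ZS (mul_mem_ZS hξ hx)), mul_one]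
      · simp [hx]
    simp only [fourier, this]
    exact integral_indicator_ZS S
  · rw [Set.indicator_of_notMem (by exact hξ)]
    obtain ⟨p, hp⟩ : ∃ p, 1 < ‖ξ p‖ := by simpa [mem_ZS] using hξ
    have hξp : 0 < ‖ξ p‖ := zero_lt_one.trans hp
    have hξ0 : ξ p ≠ 0 := norm_pos_iff.1 hξp
    have hpp : (0 : ℝ) < ((p : Nat.Primes) : ℕ) := by exact_mod_cast (p : Nat.Primes).2.pos
    -- The norm is a power of `p`, so exceeding `1` means being at least `p`; this makes `p⁻¹ ξ_p⁻¹`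
    -- integral.
    have hle : (((p : Nat.Primes) : ℕ) : ℝ) ≤ ‖ξ p‖ := by
      rw [Padic.norm_eq_zpow_neg_valuation hξ0] at hp ⊢
      have h1 : (1 : ℝ) < ((p : Nat.Primes) : ℕ) := by exact_mod_cast (p : Nat.Primes).2.one_lt
      have h2 : 0 < -(ξ p).valuation := by
        rwa [← zpow_zero (((p : Nat.Primes) : ℕ) : ℝ), zpow_lt_zpow_iff_right₀ h1] at hp
      calc (((p : Nat.Primes) : ℕ) : ℝ) = (((p : Nat.Primes) : ℕ) : ℝ) ^ (1 : ℤ) := by simp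
        _ ≤ _ := zpow_le_zpow_right₀ h1.le h2
    set y : QS S := Pi.single p ((((p : Nat.Primes) : ℕ) : ℚ_[((p : Nat.Primes) : ℕ)])⁻¹ * (ξ p)⁻¹)
    have hy : y ∈ ZS S := by
      intro q
      refine (norm_le_pi_norm y q).trans ?_
      rw [Pi.norm_single, norm_mul, norm_inv, norm_inv, Padic.norm_p, inv_inv, ← div_eq_mul_inv]
      exact div_le_one_of_le₀ hle (norm_nonneg _)
    have hχ : char (ξ * y) ≠ 1 := by
      rw [char, Finset.prod_eq_single p]
      · have e : ξ p * ((((p : Nat.Primes) : ℕ) : ℚ_[((p : Nat.Primes) : ℕ)])⁻¹ * (ξ p)⁻¹)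
            = (((p : Nat.Primes) : ℕ) : ℚ_[((p : Nat.Primes) : ℕ)])⁻¹ := by
          field_simp
        rw [Pi.mul_apply, show y p = _ from Pi.single_eq_same p _, e]
        exact padicChar_inv_ne_one
      · intro q _ hq
        rw [Pi.mul_apply, show y q = 0 from Pi.single_eq_of_ne hq _, mul_zero]
        exact padicChar_eq_one (by simp)
      · exact fun h => absurd (Finset.mem_univ p) h
    set I := (ZS S : Set (QS S)).indicator (1 : QS S → ℂ)
    have hI : ∀ x, I (x + y) = I x := by
      intro x
      have hiff : x + y ∈ (ZS S : Set (QS S)) ↔ x ∈ (ZS S : Set (QS S)) :=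
        ⟨fun h => by simpa using add_mem_ZS h (neg_mem_ZS hy), fun h => add_mem_ZS h hy⟩
      simp only [I, Set.indicator_apply, hiff, Pi.one_apply]
    have h1 : fourier I ξ = fourier I ξ * char (ξ * y) := by
      conv_lhs => rw [fourier, ← integral_add_right_eq_self _ y]
      rw [fourier, ← integral_mul_const]
      refine integral_congr_ae (Eventually.of_forall fun x => ?_)
      simp only [hI, mul_add, char_add]
      ring
    have h2 : fourier I ξ * (char (ξ * y) - 1) = 0 := by linear_combination -h1
    exact (mul_eq_zero.1 h2).resolve_right (sub_ne_zero.2 hχ)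

theorem exists_unit_norm_lt (S : Finset Nat.Primes) {ε : ℝ} (hε : 0 < ε) :
    ∃ u : (QS S)ˣ, ∀ p, ‖(u : QS S) p‖ < ε := by
  obtain ⟨k, hk⟩ := exists_pow_lt_of_lt_one hε (by norm_num : (2 : ℝ)⁻¹ < 1)
  have hu : IsUnit (fun p : S => (((p : Nat.Primes) : ℕ) : ℚ_[((p : Nat.Primes) : ℕ)]) ^ k) := by
    rw [Pi.isUnit_iff]
    intro p
    have : (((p : Nat.Primes) : ℕ) : ℚ_[((p : Nat.Primes) : ℕ)]) ≠ 0 := by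
      exact_mod_cast (p : Nat.Primes).2.ne_zero
    exact (isUnit_iff_ne_zero.2 this).pow k
  obtain ⟨u, hu⟩ := hu
  refine ⟨u, fun p => ?_⟩
  rw [hu, norm_pow, Padic.norm_p]
  refine lt_of_le_of_lt ?_ hk
  have h2 : (2 : ℝ) ≤ ((p : Nat.Primes) : ℕ) := by exact_mod_cast (p : Nat.Primes).2.two_le
  gcongr

theorem integrable_testFun {φ : QS S → ℂ} (hφ : φ ∈ testFun S) : Integrable φ (haar S) :=
  hφ.1.continuous.integrable_of_hasCompactSupport hφ.2

theorem integrable_indicator_ZS_mul (u : (QS S)ˣ) :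
    Integrable (fun x => (ZS S : Set (QS S)).indicator (1 : QS S → ℂ) ((u : QS S) * x)) (haar S) := by
  have hcomp : IsCompact (unitMul u ⁻¹' (ZS S : Set (QS S))) :=
    (unitMul u).isCompact_preimage.2 (ZS S).isCompact
  have h : Integrable ((unitMul u ⁻¹' (ZS S : Set (QS S))).indicator fun _ => (1 : ℂ)) (haar S) :=
    (integrable_indicator_iff hcomp.isClosed.measurableSet).2
      (integrableOn_const hcomp.measure_lt_top.ne (by simp))
  exact h

/-- Fourier inversion for test functions. -/
theorem fourierInv_fourier {φ : QS S → ℂ} (hφ : φ ∈ testFun S) (x : QS S) :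
    fourierInv (fourier φ) x = φ x := by
  classical
  obtain ⟨δ, hδ, hinv⟩ := testFun_uniform hφ
  obtain ⟨R, hR0, hR⟩ := (fourier_mem_testFun hφ).2.isCompact.isBounded.exists_pos_norm_le
  -- The bound `R⁻¹` makes the cutoff `I(uξ)` equal to `1` on the support of `φ̂`; the bound `δ`
  -- makes `φ` constant on `x + u ℤ_S`.
  obtain ⟨u, hu⟩ := exists_unit_norm_lt S (lt_min hδ (inv_pos.2 hR0))
  obtain ⟨c, hc⟩ := integral_mul_left_eq u
  set I := (ZS S : Set (QS S)).indicator (1 : QS S → ℂ)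
  have huI := integrable_indicator_ZS_mul u
  have h1 : fourierInv (fourier φ) x
      = ∫ ξ, fourier φ ξ * (I ((u : QS S) * ξ) * char (-x * ξ)) ∂(haar S) := by
    refine integral_congr_ae (Eventually.of_forall fun ξ => ?_)
    simp only
    by_cases hξ : ξ ∈ tsupport (fourier φ)
    · have hmem : (u : QS S) * ξ ∈ (ZS S : Set (QS S)) := by
        intro p
        rw [Pi.mul_apply, norm_mul]
        have h2 := (hu p).le.trans (min_le_right _ _)
        have h3 := (norm_le_pi_norm ξ p).trans (hR ξ hξ)
        calc _ ≤ R⁻¹ * R := by gcongr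
          _ = 1 := inv_mul_cancel₀ hR0.ne'
      simp only [I]
      rw [Set.indicator_of_mem hmem, Pi.one_apply, one_mul, neg_mul]
    · simp [image_eq_zero_of_notMem_tsupport hξ]
  -- The transform of the modulated cutoff is a multiple of the indicator of `x + u ℤ_S`, an exact
  -- approximate identity for `φ` at `x`.
  have h2 : ∀ y, fourier (fun ξ => I ((u : QS S) * ξ) * char (-x * ξ)) y
      = c * I (((u⁻¹ : (QS S)ˣ) : QS S) * (y - x)) := by
    intro y
    rw [show I (((u⁻¹ : (QS S)ˣ) : QS S) * (y - x)) = fourier I _ from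
      (fourier_indicator_ZS _).symm, fourier, fourier, ← hc]
    refine integral_congr_ae (Eventually.of_forall fun ξ => ?_)
    simp only
    rw [mul_assoc, ← char_add]
    congr 2
    have : ((u⁻¹ : (QS S)ˣ) : QS S) * (y - x) * ((u : QS S) * ξ)
        = (((u⁻¹ : (QS S)ˣ) : QS S) * (u : QS S)) * ((y - x) * ξ) := by ring
    rw [this, Units.inv_mul]
    ring
  rw [h1, integral_fourier_mul (integrable_testFun hφ) (integrable_mul_char huI _),
    integral_congr_ae (Eventually.of_forall fun y => congrArg (φ y * ·) (h2 y))]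
  have h3 : ∀ y, φ (y + x) * (c * I (((u⁻¹ : (QS S)ˣ) : QS S) * (y + x - x)))
      = c * ((fun y => φ (x + (u : QS S) * y) * I y) (((u⁻¹ : (QS S)ˣ) : QS S) * y)) := by
    intro y
    have ha : (u : QS S) * (((u⁻¹ : (QS S)ˣ) : QS S) * y) = y := Units.mul_inv_cancel_left u y
    have hb : y + x - x = y := by ring
    beta_reduce
    rw [ha, hb, add_comm y x]
    ring
  rw [← integral_add_right_eq_self
    (fun y => φ y * (c * I (((u⁻¹ : (QS S)ˣ) : QS S) * (y - x)))) x,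
    integral_congr_ae (Eventually.of_forall h3)]
  -- Rescaling by `u⁻¹` produces the inverse modulus, so `c` drops out.
  have h5 : ∀ F : QS S → ℂ,
      c * ∫ y, F (((u⁻¹ : (QS S)ˣ) : QS S) * y) ∂(haar S) = ∫ y, F y ∂(haar S) := fun F => by
    rw [← hc fun y => F (((u⁻¹ : (QS S)ˣ) : QS S) * y)]
    exact integral_congr_ae (Eventually.of_forall fun y =>
      congrArg F (Units.inv_mul_cancel_left u y))
  rw [integral_const_mul, h5 fun y => φ (x + (u : QS S) * y) * I y]
  have h4 : ∀ y, φ (x + (u : QS S) * y) * I y = φ x * I y := by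
    intro y
    by_cases hy : y ∈ (ZS S : Set (QS S))
    · rw [hinv]
      refine (pi_norm_lt_iff hδ).2 fun p => ?_
      rw [Pi.mul_apply, norm_mul]
      have h5 := (hu p).trans_le (min_le_left _ _)
      have h6 : ‖y p‖ ≤ 1 := hy p
      exact (mul_le_of_le_one_right (norm_nonneg _) h6).trans_lt h5
    · simp [I, hy]
  simp only [h4]
  rw [integral_const_mul]
  rw [integral_indicator_ZS, mul_one]

theorem fourier_fourierInv {φ : QS S → ℂ} (hφ : φ ∈ testFun S) (x : QS S) :
    fourier (fourierInv φ) x = φ x := by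
  have h : fourierInv φ = fun y => fourier φ (-y) := funext (fourierInv_eq φ)
  rw [h, fourier_comp_neg, fourierInv_fourier hφ]

/-! ### The Fourier transform on `L²(ℚ_S)` -/

/-- A continuous function with compact support on `ℚ_S` is a uniform limit of test functions with
supports in a fixed ball. -/
theorem exists_testFun_dist_le {φ : QS S → ℂ} (hc : Continuous φ) (hs : HasCompactSupport φ) :
    ∃ R : ℝ, ∀ ε > 0, ∃ ψ ∈ testFun S, (∀ x, dist (φ x) (ψ x) ≤ ε) ∧
      Function.support φ ⊆ Metric.closedBall 0 R ∧
      Function.support ψ ⊆ Metric.closedBall 0 R := by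
  obtain ⟨R, hR0, hR⟩ := hs.isCompact.isBounded.exists_pos_norm_le
  refine ⟨R + 1, fun ε hε => ?_⟩
  obtain ⟨δ, hδ, hφ⟩ := Metric.uniformContinuous_iff.1
    (hs.uniformContinuous_of_continuous hc) ε hε
  set r := min (δ / 2) 1
  have hr : 0 < r := lt_min (half_pos hδ) one_pos
  have hrδ : r < δ := (min_le_left _ _).trans_lt (half_lt_self hδ)
  -- By the ultrametric inequality the ball of radius `r` is a subgroup. Evaluating `φ` at one
  -- representative of each coset gives a locally constant function, close to `φ` because `r < δ`;
  -- `r ≤ 1` controls its support.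
  let B : AddSubgroup (QS S) :=
    { carrier := {x | ‖x‖ ≤ r}
      zero_mem' := by simpa using hr.le
      add_mem' := fun {x y} hx hy => (IsUltrametricDist.norm_add_le_max x y).trans (max_le hx hy)
      neg_mem' := fun {x} hx => by simpa using hx }
  let rep : QS S → QS S := fun x => (QuotientAddGroup.mk x : QS S ⧸ B).out
  have hrep : ∀ x, ‖x - rep x‖ ≤ r := fun x => by
    have h : (QuotientAddGroup.mk (rep x) : QS S ⧸ B) = QuotientAddGroup.mk x :=
      Quotient.out_eq _
    have h2 : -rep x + x ∈ B := QuotientAddGroup.eq.1 h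
    rw [sub_eq_neg_add]
    exact h2
  have hconst : ∀ x y, ‖y - x‖ ≤ r → rep y = rep x := fun x y h => by
    have h2 : -x + y ∈ B := by rw [← sub_eq_neg_add]; exact h
    exact congrArg Quotient.out (QuotientAddGroup.eq.2 h2).symm
  have hsφ : Function.support φ ⊆ Metric.closedBall 0 R := fun x hx => by
    simpa using hR x (subset_tsupport _ hx)
  have hsψ : Function.support (fun x => φ (rep x)) ⊆ Metric.closedBall 0 (R + 1) := fun x hx => by
    have h1 : ‖rep x‖ ≤ R := hR _ (subset_tsupport _ hx)
    have h2 : ‖x - rep x‖ ≤ 1 := (hrep x).trans (min_le_right _ _)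
    rw [mem_closedBall_zero_iff]
    calc ‖x‖ = ‖rep x + (x - rep x)‖ := by congr 1; ring
      _ ≤ _ := norm_add_le _ _
      _ ≤ _ := add_le_add h1 h2
  refine ⟨fun x => φ (rep x), ⟨?_, ?_⟩, fun x => ?_,
    hsφ.trans (Metric.closedBall_subset_closedBall (by linarith)), hsψ⟩
  · rw [IsLocallyConstant.iff_eventually_eq]
    intro x
    filter_upwards [Metric.ball_mem_nhds x hr] with y hy
    rw [hconst x y]
    rw [← dist_eq_norm]
    exact (Metric.mem_ball.1 hy).le
  · refine HasCompactSupport.intro (isCompact_closedBall (0 : QS S) (R + 1)) fun x hx => ?_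
    by_contra h
    exact hx (hsψ h)
  · refine (hφ ?_).le
    rw [dist_eq_norm]
    exact (hrep x).trans_lt hrδ

/-- Continuous functions with compact support are dense. Uniform approximation of one of them by
test functions supported in a fixed ball of finite measure is also `L²` approximation. -/
theorem denseRange_testToL2 (S : Finset Nat.Primes) : DenseRange (testToL2 S) := by
  have : (haar S).Regular := Measure.regular_addHaarMeasure
  refine fun f => Metric.mem_closure_iff.2 fun ε hε => ?_
  have hε4 : 0 < ENNReal.ofReal (ε / 4) := by simpa using hε
  obtain ⟨φ, hφs, hφ, hφc, hφ2⟩ := (Lp.memLp f).exists_hasCompactSupport_eLpNorm_sub_le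
    ENNReal.ofNat_ne_top (ε := ENNReal.ofReal (ε / 4)) hε4.ne'
  obtain ⟨R, hR⟩ := exists_testFun_dist_le hφc hφs
  have hlim : Tendsto (fun c : ℝ => ENNReal.ofReal c *
      haar S (Metric.closedBall 0 R) ^ (1 / (2 : ℝ≥0∞).toReal)) (𝓝[>] 0) (𝓝 0) := by
    have h1 : haar S (Metric.closedBall 0 R) ^ (1 / (2 : ℝ≥0∞).toReal) ≠ ∞ :=
      ENNReal.rpow_ne_top_of_nonneg (by positivity)
        (isCompact_closedBall (0 : QS S) R).measure_lt_top.ne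
    have h2 : Tendsto (fun c : ℝ => ENNReal.ofReal c) (𝓝[>] 0) (𝓝 0) := by
      have := (ENNReal.continuous_ofReal.tendsto 0).mono_left
        (nhdsWithin_le_nhds (s := Set.Ioi (0 : ℝ)))
      simpa using this
    have := ENNReal.Tendsto.mul_const h2 (Or.inr h1)
    simpa using this
  obtain ⟨c, hc, hc0⟩ := ((hlim.eventually (gt_mem_nhds hε4)).and self_mem_nhdsWithin).exists
  obtain ⟨ψ, hψ, hd, hsφ, hsψ⟩ := hR c hc0
  refine ⟨testToL2 S ⟨ψ, hψ⟩, ⟨_, rfl⟩, ?_⟩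
  have h1 := eLpNorm_sub_le_of_dist_bdd (haar S) (p := 2) ENNReal.ofNat_ne_top
    Metric.isClosed_closedBall.measurableSet (le_of_lt hc0) hd hsφ hsψ
  have h2 : edist f (testToL2 S ⟨ψ, hψ⟩) = eLpNorm (f - ψ : QS S → ℂ) 2 (haar S) := by
    rw [Lp.edist_def]
    refine eLpNorm_congr_ae ?_
    filter_upwards [MemLp.coeFn_toLp (memLp_testFun hψ)] with x hx
    rw [Pi.sub_apply, Pi.sub_apply]
    congr 1
  rw [← edist_lt_ofReal, h2, show (f - ψ : QS S → ℂ) = (f - φ) + (φ - ψ) by abel]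
  refine (eLpNorm_add_le ((Lp.aestronglyMeasurable f).sub hφ2.1)
    (hφ2.1.sub (memLp_testFun hψ).1) one_le_two).trans_lt ?_
  refine (add_le_add hφ (h1.trans hc.le)).trans_lt ?_
  rw [← ENNReal.ofReal_add (by positivity) (by positivity), ENNReal.ofReal_lt_ofReal_iff hε]
  linarith

theorem inner_toLp {f g : QS S → ℂ} (hf : MemLp f 2 (haar S)) (hg : MemLp g 2 (haar S)) :
    inner ℂ (hf.toLp f) (hg.toLp g) = ∫ x, g x * conj (f x) ∂(haar S) := by
  rw [L2.inner_def]
  refine integral_congr_ae ?_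
  filter_upwards [hf.coeFn_toLp, hg.coeFn_toLp] with x h1 h2
  rw [h1, h2]
  rfl

theorem conj_mem_testFun {φ : QS S → ℂ} (hφ : φ ∈ testFun S) :
    (fun x => conj (φ x)) ∈ testFun S :=
  ⟨hφ.1.comp conj, hφ.2.comp_left (map_zero _)⟩

/-- The multiplication formula moves the transform from `ψ` onto the conjugate of `φ̂`, where
inversion returns the conjugate of `φ`. -/
theorem inner_testToL2_fourierTest (φ ψ : testFun S) :
    inner ℂ (testToL2 S (fourierTest S φ)) (testToL2 S (fourierTest S ψ))
      = inner ℂ (testToL2 S φ) (testToL2 S ψ) := by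
  refine (inner_toLp (memLp_testFun (fourierTest S φ).2)
    (memLp_testFun (fourierTest S ψ).2)).trans (Eq.trans ?_
    (inner_toLp (memLp_testFun φ.2) (memLp_testFun ψ.2)).symm)
  have hφ := fourier_mem_testFun φ.2
  refine (integral_fourier_mul (integrable_testFun ψ.2)
    (integrable_testFun (conj_mem_testFun hφ))).trans ?_
  refine integral_congr_ae (Eventually.of_forall fun x => ?_)
  simp only
  rw [fourier_conj, fourierInv_fourier φ.2]

theorem norm_testToL2_fourierTest (φ : testFun S) :
    ‖testToL2 S (fourierTest S φ)‖ = ‖testToL2 S φ‖ := by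
  rw [@norm_eq_sqrt_re_inner ℂ, inner_testToL2_fourierTest, ← @norm_eq_sqrt_re_inner ℂ]

theorem fourierTest_fourierInvTest (φ : testFun S) : fourierTest S (fourierInvTest S φ) = φ :=
  Subtype.ext (funext (fourier_fourierInv φ.2))

theorem fourierInvTest_fourierTest (φ : testFun S) : fourierInvTest S (fourierTest S φ) = φ :=
  Subtype.ext (funext (fourierInv_fourier φ.2))

theorem norm_testToL2_fourierInvTest (φ : testFun S) :
    ‖testToL2 S (fourierInvTest S φ)‖ = ‖testToL2 S φ‖ := by
  rw [← norm_testToL2_fourierTest, fourierTest_fourierInvTest]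

/-- The extension by continuity agrees with the original map only given density and a norm bound;
Plancherel on test functions provides the latter. -/
theorem fourierL2_testToL2 (φ : testFun S) :
    fourierL2 S (testToL2 S φ) = testToL2 S (fourierTest S φ) :=
  LinearMap.extendOfNorm_eq (denseRange_testToL2 S)
    ⟨1, fun φ => by rw [one_mul]; exact (norm_testToL2_fourierTest φ).le⟩ φ

theorem fourierInvL2_testToL2 (φ : testFun S) :
    fourierInvL2 S (testToL2 S φ) = testToL2 S (fourierInvTest S φ) :=
  LinearMap.extendOfNorm_eq (denseRange_testToL2 S)
    ⟨1, fun φ => by rw [one_mul]; exact (norm_testToL2_fourierInvTest φ).le⟩ φ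

theorem fourierL2_fourierInvL2 (f : L2 S) : fourierL2 S (fourierInvL2 S f) = f := by
  refine (denseRange_testToL2 S).induction_on f (isClosed_eq (by fun_prop) continuous_id)
    fun φ => ?_
  rw [fourierInvL2_testToL2, fourierL2_testToL2, fourierTest_fourierInvTest]

theorem fourierInvL2_fourierL2 (f : L2 S) : fourierInvL2 S (fourierL2 S f) = f := by
  refine (denseRange_testToL2 S).induction_on f (isClosed_eq (by fun_prop) continuous_id)
    fun φ => ?_
  rw [fourierL2_testToL2, fourierInvL2_testToL2, fourierInvTest_fourierTest]

/-- Plancherel's theorem. -/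
theorem norm_fourierL2 (f : L2 S) : ‖fourierL2 S f‖ = ‖f‖ := by
  refine (denseRange_testToL2 S).induction_on f (isClosed_eq (by fun_prop) (by fun_prop))
    fun φ => ?_
  rw [fourierL2_testToL2, norm_testToL2_fourierTest]

theorem inner_fourierInvL2 (f g : L2 S) :
    inner ℂ f (fourierInvL2 S g) = inner ℂ (fourierL2 S f) g := by
  let U : L2 S →ₗᵢ[ℂ] L2 S := ⟨(fourierL2 S).toLinearMap, norm_fourierL2⟩
  have := U.inner_map_map f (fourierInvL2 S g)
  rw [← this]
  exact congrArg (inner ℂ (fourierL2 S f)) (fourierL2_fourierInvL2 g)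

/-- A locally square integrable function which is orthogonal to all test functions vanishes. -/
theorem ae_eq_zero_of_integral_testFun_eq_zero {h : QS S → ℂ}
    (h2 : ∀ n : ℕ, MemLp ((Metric.closedBall 0 (n + 1 : ℝ)).indicator h) 2 (haar S))
    (h0 : ∀ φ ∈ testFun S, ∫ x, h x * conj (φ x) ∂(haar S) = 0) : h =ᵐ[haar S] 0 := by
  classical
  have key : ∀ n : ℕ, (Metric.closedBall 0 (n + 1 : ℝ)).indicator h =ᵐ[haar S] 0 := by
    intro n
    have hdense : Dense ((LinearMap.range (testToL2 S) : Submodule ℂ (L2 S)) : Set (L2 S)) := by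
      rw [LinearMap.coe_range]
      exact denseRange_testToL2 S
    have hz : (h2 n).toLp _ = 0 := by
      refine hdense.eq_zero_of_inner_right (𝕜 := ℂ) ?_
      rintro _ ⟨φ, rfl⟩
      refine (inner_toLp (memLp_testFun φ.2) (h2 n)).trans ?_
      -- Balls are clopen, so the cutoff can be moved from `h` onto the test function.
      have hmem : (Metric.closedBall (0 : QS S) (n + 1 : ℝ)).indicator φ.1 ∈ testFun S := by
        have hclopen : IsClopen (Metric.closedBall (0 : QS S) (n + 1 : ℝ)) :=
          IsUltrametricDist.isClopen_closedBall _ (by positivity)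
        refine ⟨?_, ?_⟩
        · rw [IsLocallyConstant.iff_eventually_eq]
          intro x
          have h3 := (IsLocallyConstant.iff_eventually_eq _).1 φ.2.1 x
          by_cases hx : x ∈ Metric.closedBall (0 : QS S) (n + 1 : ℝ)
          · filter_upwards [h3, hclopen.isOpen.mem_nhds hx] with y hy hy'
            rw [Set.indicator_of_mem hx, Set.indicator_of_mem hy', hy]
          · filter_upwards [hclopen.compl.isOpen.mem_nhds hx] with y hy'
            rw [Set.indicator_of_notMem hx, Set.indicator_of_notMem hy']
        · refine HasCompactSupport.intro (isCompact_closedBall (0 : QS S) (n + 1 : ℝ))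
            fun x hx => Set.indicator_of_notMem hx _
      rw [← h0 _ hmem]
      refine integral_congr_ae (Eventually.of_forall fun x => ?_)
      by_cases hx : x ∈ Metric.closedBall (0 : QS S) (n + 1 : ℝ) <;> simp [hx]
    filter_upwards [(h2 n).coeFn_toLp, Lp.coeFn_zero ℂ 2 (haar S)] with x h3 h4
    rw [← h3, hz, h4]
  filter_upwards [ae_all_iff.2 key] with x hx
  obtain ⟨n, hn⟩ := exists_nat_gt ‖x‖
  have := hx n
  rwa [Set.indicator_of_mem (by simpa using hn.le.trans (by linarith))] at this

theorem memLp_indicator_of_continuous {h : QS S → ℂ} (hc : Continuous h) (R : ℝ) :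
    MemLp ((Metric.closedBall 0 R).indicator h) 2 (haar S) := by
  have hcomp : IsCompact (Metric.closedBall (0 : QS S) R) := isCompact_closedBall _ _
  rw [memLp_indicator_iff_restrict hcomp.isClosed.measurableSet]
  have : IsFiniteMeasure ((haar S).restrict (Metric.closedBall 0 R)) :=
    ⟨by simpa using hcomp.measure_lt_top⟩
  obtain ⟨C, hC⟩ := hcomp.exists_bound_of_continuousOn hc.continuousOn
  exact MemLp.of_bound hc.aestronglyMeasurable C
    (ae_restrict_of_forall_mem hcomp.isClosed.measurableSet hC)

/-- On `L¹ ∩ L²` the inverse Fourier transform is given by the Fourier integral. -/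
theorem coeFn_fourierInvL2_toLp {g : QS S → ℂ} (hg : Integrable g (haar S))
    (hg2 : MemLp g 2 (haar S)) : fourierInvL2 S (hg2.toLp g) =ᵐ[haar S] fourierInv g := by
  set F := fourierInvL2 S (hg2.toLp g)
  have hcont : Continuous (fourierInv g) := by
    rw [show fourierInv g = fun x => fourier g (-x) from funext (fourierInv_eq g)]
    exact (continuous_fourier hg).comp continuous_neg
  -- At this stage `fourierInv g` is only known to be continuous, so the difference is only locally
  -- square integrable; it is tested against test functions.
  have hsub : (fun x => F x - fourierInv g x) =ᵐ[haar S] 0 := by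
    refine ae_eq_zero_of_integral_testFun_eq_zero (fun n => ?_) fun φ hφ => ?_
    · have := ((Lp.memLp F).indicator (s := Metric.closedBall 0 (n + 1 : ℝ))
        Metric.isClosed_closedBall.measurableSet).sub (memLp_indicator_of_continuous hcont (n + 1))
      rwa [← Set.indicator_sub'] at this
    · have hi1 : Integrable (fun x => F x * conj (φ x)) (haar S) :=
        (Lp.memLp F).integrable_mul (memLp_testFun (conj_mem_testFun hφ))
      have hi2 : Integrable (fun x => fourierInv g x * conj (φ x)) (haar S) :=
        (hcont.mul (conj_mem_testFun hφ).1.continuous).integrable_of_hasCompactSupport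
          (conj_mem_testFun hφ).2.mul_left
      simp only [sub_mul]
      rw [integral_sub hi1 hi2, sub_eq_zero]
      have e1 : ∫ x, F x * conj (φ x) ∂(haar S) = inner ℂ (testToL2 S ⟨φ, hφ⟩) F := by
        have := inner_toLp (memLp_testFun hφ) (Lp.memLp F)
        rw [Lp.toLp_coeFn] at this
        exact this.symm
      rw [e1, inner_fourierInvL2, fourierL2_testToL2,
        integral_fourierInv_mul hg (integrable_testFun (conj_mem_testFun hφ))]
      refine (inner_toLp (memLp_testFun (fourierTest S ⟨φ, hφ⟩).2) hg2).trans ?_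
      refine integral_congr_ae (Eventually.of_forall fun x => ?_)
      simp only [fourierInv_conj]
      rfl
  filter_upwards [hsub] with x hx
  exact sub_eq_zero.1 hx

theorem memLp_fourierInv {g : QS S → ℂ} (hg : Integrable g (haar S))
    (hg2 : MemLp g 2 (haar S)) : MemLp (fourierInv g) 2 (haar S) :=
  (memLp_congr_ae (coeFn_fourierInvL2_toLp hg hg2)).1 (Lp.memLp _)

theorem memLp_comp_sub_left {f : QS S → ℂ} (hf : MemLp f 2 (haar S)) (x : QS S) :
    MemLp (fun y => f (x - y)) 2 (haar S) :=
  hf.comp_measurePreserving (Measure.measurePreserving_sub_left (haar S) x)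

/-- Fourier multipliers are convolutions. -/
theorem coeFn_fourierInvL2_mul {b : QS S → ℝ} (hb : Integrable (fun ξ => (b ξ : ℂ)) (haar S))
    (hb2 : MemLp (fun ξ => (b ξ : ℂ)) 2 (haar S)) (f G : L2 S)
    (hG : G =ᵐ[haar S] fun ξ => (b ξ : ℂ) * fourierL2 S f ξ) :
    fourierInvL2 S G =ᵐ[haar S]
      fun x => ∫ y, f (x - y) * fourierInv (fun ξ => (b ξ : ℂ)) y ∂(haar S) := by
  set B : QS S → ℂ := fun ξ => (b ξ : ℂ)
  have hG1 : Integrable G (haar S) :=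
    (hb2.integrable_mul (Lp.memLp (fourierL2 S f))).congr hG.symm
  have h1 := coeFn_fourierInvL2_toLp hG1 (Lp.memLp G)
  rw [Lp.toLp_coeFn] at h1
  refine h1.trans (Eventually.of_forall fun x => ?_)
  have hk1 := integrable_mul_char hb x
  have hk2 := memLp_mul_char hb2 x
  -- For fixed `x` the integral pairs `b χ(x·)` with `ℱf`. Moving the transform to the other side
  -- leaves `f` paired with a translated and reflected transform of `b`; since `b` is real,
  -- conjugation affects only the character.
  have e1 : fourierInv G x = inner ℂ (hk2.toLp _) (fourierL2 S f) := by
    have := inner_toLp hk2 (Lp.memLp (fourierL2 S f))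
    rw [Lp.toLp_coeFn] at this
    rw [this]
    refine integral_congr_ae ?_
    filter_upwards [hG] with ξ hξ
    rw [hξ, map_mul, ← char_neg]
    simp only [B, Complex.conj_ofReal]
    ring
  have e2 : inner ℂ (hk2.toLp _) (fourierL2 S f) = inner ℂ (fourierInvL2 S (hk2.toLp _)) f := by
    rw [← inner_conj_symm, ← inner_fourierInvL2, inner_conj_symm]
  have e3 := inner_toLp (memLp_fourierInv hk1 hk2) (Lp.memLp f)
  rw [Lp.toLp_coeFn] at e3
  have e4 : fourierInvL2 S (hk2.toLp _) = (memLp_fourierInv hk1 hk2).toLp _ :=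
    Lp.ext ((coeFn_fourierInvL2_toLp hk1 hk2).trans (MemLp.coeFn_toLp _).symm)
  have e5 : ∀ z, conj (fourierInv (fun ξ => B ξ * char (x * ξ)) z) = fourierInv B (x - z) := by
    intro z
    rw [fourierInv, fourierInv, ← integral_conj]
    refine integral_congr_ae (Eventually.of_forall fun ξ => ?_)
    simp only [map_mul, ← char_neg, neg_neg]
    rw [mul_assoc, ← char_add]
    simp only [B, Complex.conj_ofReal]
    congr 2
    ring
  rw [e1, e2, e4, e3]
  simp only [e5]
  rw [← integral_sub_left_eq_self _ (haar S) x]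
  simp

/-! ### The ultrametric norm -/

theorem expPsiNat_ne_zero (S : Finset Nat.Primes) (n : ℕ) : expPsiNat S n ≠ 0 := by
  rw [expPsiNat, Ne, Finset.lcm_eq_zero_iff]
  rintro ⟨m, hm, hm0⟩
  simp at hm
  simp at hm0
  omega

theorem expPsiNat_dvd {m n : ℕ} (h : m ≤ n) : expPsiNat S m ∣ expPsiNat S n := by
  classical
  exact Finset.lcm_mono (Finset.filter_subset_filter _ (Finset.Icc_subset_Icc_right h))

theorem pow_dvd_expPsiNat (p : S) {l n : ℕ} (h : ((p : Nat.Primes) : ℕ) ^ l ≤ n) :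
    ((p : Nat.Primes) : ℕ) ^ l ∣ expPsiNat S n := by
  classical
  refine Finset.dvd_lcm (f := id) ?_
  simp only [Finset.mem_filter, Finset.mem_Icc]
  exact ⟨⟨Nat.pos_of_ne_zero (pow_ne_zero _ (p : Nat.Primes).2.ne_zero), h⟩, p, p.2, l, rfl⟩

theorem padic_norm_natCast_le_of_dvd {p : ℕ} [Fact p.Prime] {a b : ℕ} (h : a ∣ b) :
    ‖(b : ℚ_[p])‖ ≤ ‖(a : ℚ_[p])‖ := by
  obtain ⟨c, rfl⟩ := h
  rw [Nat.cast_mul, norm_mul]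
  refine mul_le_of_le_one_right (norm_nonneg _) ?_
  exact_mod_cast Padic.norm_int_le_one (p := p) c

theorem expPsi_of_nonneg {n : ℤ} (h : 0 ≤ n) : expPsi S n = expPsiNat S n.natAbs := if_pos h

theorem expPsi_of_neg {n : ℤ} (h : n < 0) : expPsi S n = (expPsiNat S n.natAbs : ℚ)⁻¹ :=
  if_neg (not_le.2 h)

theorem expPsi_ne_zero (S : Finset Nat.Primes) (n : ℤ) : expPsi S n ≠ 0 := by
  have := expPsiNat_ne_zero S n.natAbs
  rw [expPsi]
  split_ifs <;> simpa

theorem norm_natCast_expPsiNat_le_one (p : S) (n : ℕ) :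
    ‖((expPsiNat S n : ℕ) : ℚ_[((p : Nat.Primes) : ℕ)])‖ ≤ 1 := by
  simpa using padic_norm_natCast_le_of_dvd (p := ((p : Nat.Primes) : ℕ)) (one_dvd (expPsiNat S n))

/-- The numbers `e^{ψ(n)}`, `n ≥ 0`, form a divisibility chain, and `ψ` is odd. Hence the lattices
are nested, which is what makes `order` well behaved. -/
theorem norm_expPsi_antitone (p : S) {m n : ℤ} (h : m ≤ n) :
    ‖((expPsi S n : ℚ) : ℚ_[((p : Nat.Primes) : ℕ)])‖
      ≤ ‖((expPsi S m : ℚ) : ℚ_[((p : Nat.Primes) : ℕ)])‖ := by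
  have hpos : ∀ n, 0 < ‖((expPsiNat S n : ℕ) : ℚ_[((p : Nat.Primes) : ℕ)])‖ := fun n =>
    norm_pos_iff.2 (by exact_mod_cast expPsiNat_ne_zero S n)
  rcases lt_or_ge m 0 with hm | hm <;> rcases lt_or_ge n 0 with hn | hn
  · rw [expPsi_of_neg hm, expPsi_of_neg hn]
    simp only [Rat.cast_inv, Rat.cast_natCast, norm_inv]
    exact inv_anti₀ (hpos _) (padic_norm_natCast_le_of_dvd (expPsiNat_dvd (by omega)))
  · rw [expPsi_of_neg hm, expPsi_of_nonneg hn]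
    simp only [Rat.cast_inv, Rat.cast_natCast, norm_inv]
    exact (norm_natCast_expPsiNat_le_one p _).trans
      ((one_le_inv₀ (hpos _)).2 (norm_natCast_expPsiNat_le_one p _))
  · omega
  · rw [expPsi_of_nonneg hm, expPsi_of_nonneg hn]
    simp only [Rat.cast_natCast]
    exact padic_norm_natCast_le_of_dvd (expPsiNat_dvd (by omega))

theorem mem_lattice_iff {n : ℤ} {x : QS S} :
    x ∈ lattice S n ↔ ∀ p, ‖x p‖ ≤ ‖((expPsi S n : ℚ) : ℚ_[((p : Nat.Primes) : ℕ)])‖ := by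
  have h0 : ∀ p : S, ((expPsi S n : ℚ) : ℚ_[((p : Nat.Primes) : ℕ)]) ≠ 0 := fun p => by
    exact_mod_cast expPsi_ne_zero S n
  constructor
  · rintro ⟨z, hz, hx⟩ p
    rw [hx p, norm_mul]
    exact mul_le_of_le_one_right (norm_nonneg _) (hz p)
  · intro h
    refine ⟨fun p => ((expPsi S n : ℚ) : ℚ_[((p : Nat.Primes) : ℕ)])⁻¹ * x p, fun p => ?_,
      fun p => (mul_inv_cancel_left₀ (h0 p) _).symm⟩
    rw [norm_mul, norm_inv]
    exact inv_mul_le_one_of_le₀ (h p) (norm_nonneg _)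

theorem lattice_antitone {m n : ℤ} (h : m ≤ n) : lattice S n ⊆ lattice S m := fun _ hx =>
  mem_lattice_iff.2 fun p => (mem_lattice_iff.1 hx p).trans (norm_expPsi_antitone p h)

theorem isClosed_lattice (S : Finset Nat.Primes) (n : ℤ) : IsClosed (lattice S n) := by
  have : lattice S n = ⋂ p : S, {x : QS S | ‖x p‖
      ≤ ‖((expPsi S n : ℚ) : ℚ_[((p : Nat.Primes) : ℕ)])‖} := by
    ext x; simp [mem_lattice_iff]
  rw [this]
  exact isClosed_iInter fun p => isClosed_le (continuous_apply p).norm continuous_const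

theorem exists_mem_lattice (x : QS S) : ∃ n : ℤ, x ∈ lattice S n := by
  classical
  have h1 : ∀ p : S, ∃ l : ℕ, ‖x p‖ ≤ (((p : Nat.Primes) : ℕ) : ℝ) ^ l := fun p => by
    obtain ⟨l, hl⟩ := pow_unbounded_of_one_lt ‖x p‖
      (by exact_mod_cast (p : Nat.Primes).2.one_lt : (1 : ℝ) < ((p : Nat.Primes) : ℕ))
    exact ⟨l, hl.le⟩
  choose l hl using h1
  -- The sum dominates every `p ^ l p`, so each of them divides `e^{ψ(M)}`.
  set M : ℕ := ∑ p : S, ((p : Nat.Primes) : ℕ) ^ l p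
  refine ⟨-(M : ℤ), mem_lattice_iff.2 fun p => ?_⟩
  have hM : ((p : Nat.Primes) : ℕ) ^ l p ≤ M :=
    Finset.single_le_sum (f := fun p : S => ((p : Nat.Primes) : ℕ) ^ l p)
      (fun _ _ => Nat.zero_le _) (Finset.mem_univ p)
  have hM0 : 0 < M := lt_of_lt_of_le
    (Nat.pos_of_ne_zero (pow_ne_zero _ (p : Nat.Primes).2.ne_zero)) hM
  rw [expPsi_of_neg (by omega)]
  simp only [Int.natAbs_neg, Int.natAbs_natCast, Rat.cast_inv, Rat.cast_natCast, norm_inv]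
  have h2 := padic_norm_natCast_le_of_dvd (p := ((p : Nat.Primes) : ℕ)) (pow_dvd_expPsiNat p hM)
  rw [Nat.cast_pow, norm_pow, Padic.norm_p, inv_pow] at h2
  refine (hl p).trans ?_
  rw [le_inv_comm₀ (pow_pos (by exact_mod_cast (p : Nat.Primes).2.pos) _)
    (norm_pos_iff.2 (by exact_mod_cast expPsiNat_ne_zero S M))]
  exact h2

/-- If `|x_p| > p^{-l}`, then no `n ≥ p^l` is possible, since `p^l` divides `e^{ψ(n)}`. -/
theorem bddAbove_lattice {x : QS S} (hx : x ≠ 0) : BddAbove {n : ℤ | x ∈ lattice S n} := by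
  obtain ⟨p, hp⟩ : ∃ p, x p ≠ 0 := by
    by_contra! h
    exact hx (funext h)
  have hp1 : (1 : ℝ) < ((p : Nat.Primes) : ℕ) := by exact_mod_cast (p : Nat.Primes).2.one_lt
  obtain ⟨l, hl⟩ := exists_pow_lt_of_lt_one (norm_pos_iff.2 hp) (inv_lt_one_of_one_lt₀ hp1)
  refine ⟨((((p : Nat.Primes) : ℕ) ^ l : ℕ) : ℤ), fun n hn => ?_⟩
  by_contra! hlt
  have hn0 : 0 ≤ n := (Int.natCast_nonneg _).trans hlt.le
  have h1 := mem_lattice_iff.1 hn p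
  rw [expPsi_of_nonneg hn0, Rat.cast_natCast] at h1
  have h2 := padic_norm_natCast_le_of_dvd (p := ((p : Nat.Primes) : ℕ))
    (pow_dvd_expPsiNat p (l := l) (n := n.natAbs) (by omega))
  rw [Nat.cast_pow, norm_pow, Padic.norm_p] at h2
  linarith

theorem le_order {x : QS S} (hx : x ≠ 0) {n : ℤ} (h : x ∈ lattice S n) : n ≤ order S x :=
  le_csSup (bddAbove_lattice hx) h

theorem mem_lattice_order {x : QS S} (hx : x ≠ 0) : x ∈ lattice S (order S x) :=
  Int.csSup_mem (exists_mem_lattice x) (bddAbove_lattice hx)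

theorem order_eq_iff {x : QS S} (hx : x ≠ 0) {n : ℤ} :
    order S x = n ↔ x ∈ lattice S n \ lattice S (n + 1) := by
  constructor
  · rintro rfl
    exact ⟨mem_lattice_order hx, fun h => by have := le_order hx h; omega⟩
  · rintro ⟨h1, h2⟩
    refine le_antisymm ?_ (le_order hx h1)
    by_contra! h
    exact h2 (lattice_antitone (by omega) (mem_lattice_order hx))

/-- Off the origin the level sets of `order` are differences of closed lattices, and `ℤ` is
countable. The origin lies in every lattice and is treated apart. -/
theorem measurable_ultraNorm (S : Finset Nat.Primes) :
    Measurable (ultraNorm : QS S → ℝ) := by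
  have h1 : Measurable fun x : {x : QS S // x ≠ 0} => order S x.1 := by
    refine measurable_to_countable' fun n => ?_
    have : (fun x : {x : QS S // x ≠ 0} => order S x.1) ⁻¹' {n}
        = Subtype.val ⁻¹' (lattice S n \ lattice S (n + 1)) := by
      ext x
      exact order_eq_iff x.2
    rw [this]
    exact measurable_subtype_coe
      ((isClosed_lattice S n).measurableSet.diff (isClosed_lattice S (n + 1)).measurableSet)
  have h0 : MeasurableSet {x : QS S | x = 0} := measurableSet_singleton 0
  refine measurable_of_restrict_of_restrict_compl h0 ?_ ?_
  · have : Set.domRestrict {x : QS S | x = 0} ultraNorm = fun _ => 0 := by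
      ext ⟨x, hx⟩
      exact if_pos hx
    rw [this]
    exact measurable_const
  · have : Set.domRestrict {x : QS S | x = 0}ᶜ ultraNorm = fun x : {x : QS S // x ≠ 0} =>
        ((expPsi S (order S x.1) : ℚ) : ℝ)⁻¹ := by
      ext ⟨x, hx⟩
      exact if_neg hx
    rw [this]
    exact (measurable_from_top (f := fun n : ℤ => ((expPsi S n : ℚ) : ℝ)⁻¹)).comp h1

theorem ultraNorm_nonneg (x : QS S) : 0 ≤ ultraNorm x := by
  rw [ultraNorm]
  split_ifs
  · exact le_rfl
  · rw [expPsi]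
    split_ifs <;> positivity

/-- For negative order, `‖x‖` is itself a positive integer `k` and `x` lies in `k⁻¹ ℤ_S`. For
nonnegative order, `x` is integral and the floor may be `0`, whence the maximum with `1`. -/
theorem floor_ultraNorm_mul_mem_ZS (x : QS S) (p : S) :
    ‖((max 1 ⌊ultraNorm x⌋₊ : ℕ) : ℚ_[((p : Nat.Primes) : ℕ)]) * x p‖ ≤ 1 := by
  by_cases hx : x = 0
  · simp [hx]
  have h1 := mem_lattice_iff.1 (mem_lattice_order hx) p
  rcases lt_or_ge (order S x) 0 with hn | hn
  · have h2 : ultraNorm x = expPsiNat S (order S x).natAbs := by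
      rw [ultraNorm, if_neg hx, expPsi_of_neg hn]; simp
    have h3 := expPsiNat_ne_zero S (order S x).natAbs
    rw [expPsi_of_neg hn, Rat.cast_inv, Rat.cast_natCast, norm_inv] at h1
    rw [h2, Nat.floor_natCast, max_eq_right (Nat.one_le_iff_ne_zero.2 h3), norm_mul]
    calc _ ≤ _ := mul_le_mul_of_nonneg_left h1 (norm_nonneg _)
      _ = 1 := mul_inv_cancel₀ (norm_ne_zero_iff.2 (by exact_mod_cast h3))
  · rw [expPsi_of_nonneg hn, Rat.cast_natCast] at h1
    rw [norm_mul]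
    refine mul_le_one₀ ?_ (norm_nonneg _) (h1.trans (norm_natCast_expPsiNat_le_one p _))
    simpa using padic_norm_natCast_le_of_dvd (p := ((p : Nat.Primes) : ℕ)) (one_dvd _)

/-! ### Volumes of balls and integrability of the symbol of the heat semigroup -/

/-- Residues modulo `p^v`, `v = v_p(k)`, suffice, and they are smaller than `p^v ≤ k`. -/
theorem exists_lt_norm_sub_le {p : ℕ} [hp : Fact p.Prime] {k : ℕ} (hk : k ≠ 0) {z : ℚ_[p]}
    (hz : ‖z‖ ≤ 1) : ∃ a : Fin k, ‖z - ((a : ℕ) : ℚ_[p])‖ ≤ ‖(k : ℚ_[p])‖ := by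
  set v := padicValNat p k
  have h1 : PadicInt.appr (⟨z, hz⟩ : ℤ_[p]) v < k :=
    (PadicInt.appr_lt _ v).trans_le (Nat.le_of_dvd (Nat.pos_of_ne_zero hk) pow_padicValNat_dvd)
  refine ⟨⟨_, h1⟩, ?_⟩
  have h := (PadicInt.norm_le_pow_iff_mem_span_pow _ v).2 (PadicInt.appr_spec v ⟨z, hz⟩)
  rw [← PadicInt.padic_norm_e_of_padicInt] at h
  rw [Padic.norm_eq_zpow_neg_valuation (x := (k : ℚ_[p])) (by exact_mod_cast hk),
    Padic.valuation_natCast]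
  exact h

/-- The set is `k⁻¹ ℤ_S`, whose measure is the modulus `c` of scaling, while `A = k ℤ_S` has measure
`c⁻¹`. Covering `ℤ_S` by `k^|S|` translates of `A` bounds `c`. The exponent is not sharp, but any
polynomial bound is enough. -/
theorem haar_ball_le {k : ℕ} (hk : k ≠ 0) :
    haar S {x | ∀ p : S, ‖(k : ℚ_[((p : Nat.Primes) : ℕ)]) * x p‖ ≤ 1} ≤ (k : ℝ≥0∞) ^ S.card := by
  classical
  have hk0 : ∀ p : S, (k : ℚ_[((p : Nat.Primes) : ℕ)]) ≠ 0 := fun p => by exact_mod_cast hk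
  obtain ⟨u, hu⟩ : IsUnit (fun p : S => (k : ℚ_[((p : Nat.Primes) : ℕ)])) :=
    Pi.isUnit_iff.2 fun p => isUnit_iff_ne_zero.2 (hk0 p)
  have hup : ∀ p, (u : QS S) p = k := fun p => congrFun hu p
  obtain ⟨c, hc⟩ := map_mul_haar u
  set A : Set (QS S) := (unitMul u).symm ⁻¹' (ZS S : Set (QS S)) with hA
  have hmap : ∀ E : Set (QS S), haar S (unitMul u ⁻¹' E) = c * haar S E := fun E => by
    have h := (unitMul u).measurableEmbedding.map_apply (haar S) E
    rw [hc] at h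
    rw [← h]
    rfl
  have h1 : haar S {x | ∀ p : S, ‖(k : ℚ_[((p : Nat.Primes) : ℕ)]) * x p‖ ≤ 1} = c := by
    have := hmap (ZS S : Set (QS S))
    rw [haar_ZS, mul_one] at this
    rw [← this]
    congr 1
    ext x
    refine forall_congr' fun p => ?_
    rw [← hup p]
    rfl
  have h2 : 1 = c * haar S A := by
    rw [← hmap A, hA, ← Set.preimage_comp]
    simp [haar_ZS]
  let b : (S → Fin k) → QS S := fun a p => ((a p : ℕ) : ℚ_[((p : Nat.Primes) : ℕ)])
  have hcover : (ZS S : Set (QS S)) ⊆ ⋃ a, (fun x => x + -b a) ⁻¹' A := by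
    intro z hz
    choose a ha using fun p : S => exists_lt_norm_sub_le hk (hz p)
    refine Set.mem_iUnion.2 ⟨a, fun p => ?_⟩
    have h4 : (k : ℚ_[((p : Nat.Primes) : ℕ)]) * (unitMul u).symm (z + -b a) p
        = z p - (a p : ℕ) := by
      rw [← hup p, sub_eq_add_neg]
      exact congrFun ((unitMul u).apply_symm_apply (z + -b a)) p
    have e : (unitMul u).symm (z + -b a) p
        = (k : ℚ_[((p : Nat.Primes) : ℕ)])⁻¹ * (z p - (a p : ℕ)) := by
      rw [← h4, inv_mul_cancel_left₀ (hk0 p)]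
    change ‖(unitMul u).symm (z + -b a) p‖ ≤ 1
    rw [e, norm_mul, norm_inv]
    exact inv_mul_le_one_of_le₀ (ha p) (norm_nonneg _)
  have h5 : 1 ≤ (k : ℝ≥0∞) ^ S.card * haar S A := by
    calc 1 = haar S (ZS S : Set (QS S)) := (haar_ZS S).symm
      _ ≤ _ := measure_mono hcover
      _ ≤ _ := measure_iUnion_le _
      _ = _ := by
        simp only [measure_preimage_add_right]
        rw [tsum_fintype, Finset.sum_const, Finset.card_univ]
        simp
  rw [h1]
  calc (c : ℝ≥0∞) = c * 1 := (mul_one _).symm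
    _ ≤ c * ((k : ℝ≥0∞) ^ S.card * haar S A) := by gcongr
    _ = (k : ℝ≥0∞) ^ S.card * (c * haar S A) := by ring
    _ = _ := by rw [← h2, mul_one]

theorem summable_exp_neg_mul_rpow_mul_pow {α t : ℝ} (hα : 0 < α) (ht : 0 < t) (d : ℕ) :
    Summable fun k : ℕ => Real.exp (-t * (k : ℝ) ^ α) * ((max 1 k : ℕ) : ℝ) ^ d := by
  -- After substituting `k^α`, this exponent gives decay `k^{-(d+2)}`: `d` powers absorb the
  -- polynomial factor and two ensure summability.
  have h1 := (isLittleO_exp_neg_mul_rpow_atTop ht (-(d + 2 : ℝ) / α)).comp_tendsto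
    ((tendsto_rpow_atTop hα).comp tendsto_natCast_atTop_atTop)
  refine summable_of_isBigO_nat (g := fun k : ℕ => ((k : ℝ) ^ 2)⁻¹)
    (Real.summable_nat_pow_inv.2 one_lt_two) ?_
  have h2 := h1.isBigO.mul (Asymptotics.isBigO_refl
    (fun k : ℕ => ((max 1 k : ℕ) : ℝ) ^ d) atTop)
  refine h2.trans (Asymptotics.IsBigO.of_bound 1 ?_)
  filter_upwards [eventually_ge_atTop 1] with k hk
  have hk0 : (0 : ℝ) < k := by exact_mod_cast hk
  rw [max_eq_right hk, one_mul]
  refine le_of_eq (congrArg norm ?_)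
  simp only [Function.comp]
  rw [← Real.rpow_mul hk0.le, mul_div_cancel₀ _ hα.ne', Real.rpow_neg hk0.le,
    Real.rpow_add hk0, Real.rpow_natCast, Real.rpow_ofNat]
  field_simp

/-- Space is cut into the layers where `⌊‖ξ‖⌋ = k`. Each has volume at most `max(1,k)^|S|`, and the
integrand there is at most `exp(-t k^α)`. -/
theorem integrable_exp_neg_mul_ultraNorm_rpow {α t : ℝ} (hα : 0 < α) (ht : 0 < t) :
    Integrable (fun ξ : QS S => (Real.exp (-t * ultraNorm ξ ^ α) : ℂ)) (haar S) := by
  have hm : Measurable fun ξ : QS S => Real.exp (-t * ultraNorm ξ ^ α) := by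
    have := measurable_ultraNorm S
    fun_prop
  suffices h : Integrable (fun ξ : QS S => Real.exp (-t * ultraNorm ξ ^ α)) (haar S) from h.ofReal
  refine ⟨hm.aestronglyMeasurable, ?_⟩
  have hN : Measurable fun ξ : QS S => ⌊ultraNorm ξ⌋₊ :=
    Nat.measurable_floor.comp (measurable_ultraNorm S)
  set h : ℕ → ℝ≥0∞ := fun k => ENNReal.ofReal (Real.exp (-t * (k : ℝ) ^ α))
  have h1 : ∀ k : ℕ, haar S ((fun ξ : QS S => ⌊ultraNorm ξ⌋₊) ⁻¹' {k})
      ≤ ((max 1 k : ℕ) : ℝ≥0∞) ^ S.card := fun k => by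
    refine (measure_mono ?_).trans (haar_ball_le (by omega))
    rintro ξ rfl p
    exact floor_ultraNorm_mul_mem_ZS ξ p
  rw [hasFiniteIntegral_iff_ofReal (Eventually.of_forall fun ξ => (Real.exp_pos _).le)]
  calc _ ≤ ∫⁻ ξ : QS S, h ⌊ultraNorm ξ⌋₊ ∂(haar S) := by
        refine lintegral_mono fun ξ => ENNReal.ofReal_le_ofReal (Real.exp_le_exp.2 ?_)
        have := Real.rpow_le_rpow (Nat.cast_nonneg _) (Nat.floor_le (ultraNorm_nonneg ξ)) hα.le
        nlinarith
    _ = ∑' k, h k * haar S ((fun ξ : QS S => ⌊ultraNorm ξ⌋₊) ⁻¹' {k}) := by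
        rw [← lintegral_map (f := h) measurable_from_top hN, lintegral_countable']
        simp only [Measure.map_apply hN (measurableSet_singleton _)]
    _ ≤ ∑' k : ℕ, ENNReal.ofReal
          (Real.exp (-t * (k : ℝ) ^ α) * ((max 1 k : ℕ) : ℝ) ^ S.card) := by
        refine ENNReal.tsum_le_tsum fun k => ?_
        rw [ENNReal.ofReal_mul (Real.exp_pos _).le, ENNReal.ofReal_pow (Nat.cast_nonneg _),
          ENNReal.ofReal_natCast]
        exact mul_le_mul_right (h1 k) _
    _ < ∞ := (summable_exp_neg_mul_rpow_mul_pow hα ht _).tsum_ofReal_lt_top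

theorem memLp_exp_neg_mul_ultraNorm_rpow {α t : ℝ} (hα : 0 < α) (ht : 0 < t) :
    MemLp (fun ξ : QS S => (Real.exp (-t * ultraNorm ξ ^ α) : ℂ)) 2 (haar S) := by
  rw [memLp_two_iff_integrable_sq_norm (integrable_exp_neg_mul_ultraNorm_rpow hα ht).1]
  refine (integrable_exp_neg_mul_ultraNorm_rpow (S := S) hα
    (mul_pos two_pos ht)).norm.congr (Eventually.of_forall fun ξ => ?_)
  simp only [Complex.norm_real, Real.norm_of_nonneg (Real.exp_pos _).le]
  rw [← Real.exp_nat_mul]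
  congr 1
  push_cast
  ring

/-! ### The heat semigroup -/

theorem measurable_ultraNorm_rpow (S : Finset Nat.Primes) (α : ℝ) :
    Measurable fun ξ : QS S => ultraNorm ξ ^ α :=
  (measurable_ultraNorm S).pow_const α

theorem ultraNorm_rpow_nonneg (α : ℝ) (ξ : QS S) : 0 ≤ ultraNorm ξ ^ α :=
  Real.rpow_nonneg (ultraNorm_nonneg ξ) α

/-- Multiplication by `exp(-t ‖ξ‖^α)` on `L²(ℚ_S)`. -/
def symbolSemigroup (S : Finset Nat.Primes) (α : ℝ) : C0Semigroup (L2 S) :=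
  mulSemigroup (haar S) (fun ξ => ultraNorm ξ ^ α) (measurable_ultraNorm_rpow S α)
    (ultraNorm_rpow_nonneg α)

/-- The semigroup `exp(-t D^α) = ℱ⁻¹ exp(-t ‖ξ‖^α) ℱ`. -/
def heatSemigroup (S : Finset Nat.Primes) (α : ℝ) : C0Semigroup (L2 S) where
  op t := fourierInvL2 S ∘L (symbolSemigroup S α).op t ∘L fourierL2 S
  op_zero := by
    ext1 f
    simp [C0Semigroup.op_zero_apply, fourierInvL2_fourierL2]
  op_add s t := by
    ext1 f
    simp [C0Semigroup.op_add_apply, fourierL2_fourierInvL2]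
  tendsto_zero f := by
    have := ((fourierInvL2 S).continuous.tendsto _).comp
      ((symbolSemigroup S α).tendsto_zero (fourierL2 S f))
    rw [fourierInvL2_fourierL2] at this
    exact this

theorem fourierL2_heatSemigroup (α : ℝ) (t : ℝ≥0) (f : L2 S) :
    fourierL2 S ((heatSemigroup S α).op t f) = (symbolSemigroup S α).op t (fourierL2 S f) :=
  fourierL2_fourierInvL2 _

theorem norm_heatSemigroup_le (α : ℝ) (t : ℝ≥0) (f : L2 S) :
    ‖(heatSemigroup S α).op t f‖ ≤ ‖f‖ := by
  rw [← norm_fourierL2, fourierL2_heatSemigroup, ← norm_fourierL2 f]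
  exact norm_mulSemigroup_le _ _ t _

theorem hasGenerator_heatSemigroup_iff_symbol {α : ℝ} {f g : L2 S} :
    (heatSemigroup S α).HasGenerator f g
      ↔ (symbolSemigroup S α).HasGenerator (fourierL2 S f) (fourierL2 S g) := by
  have e : ∀ t : ℝ≥0, fourierL2 S (((t : ℝ)⁻¹ : ℂ) • ((heatSemigroup S α).op t f - f))
      = ((t : ℝ)⁻¹ : ℂ) • ((symbolSemigroup S α).op t (fourierL2 S f) - fourierL2 S f) := fun t => by
    rw [map_smul, map_sub, fourierL2_heatSemigroup]
  constructor
  · intro h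
    exact (((fourierL2 S).continuous.tendsto g).comp h).congr e
  · intro h
    have := ((fourierInvL2 S).continuous.tendsto _).comp h
    rw [fourierInvL2_fourierL2] at this
    refine this.congr fun t => ?_
    rw [Function.comp, ← e, fourierInvL2_fourierL2]

theorem generator_heatSemigroup (S : Finset Nat.Primes) (α : ℝ) :
    (heatSemigroup S α).generator = -Dop S α := by
  refine C0Semigroup.generator_eq_neg fun f g => ?_
  rw [hasGenerator_heatSemigroup_iff_symbol]
  refine (hasGenerator_mulSemigroup_iff _ _ _ _).trans ?_
  constructor
  · intro h
    have hmem : MemLp (fun ξ => ((ultraNorm ξ ^ α : ℝ) : ℂ) * fourierL2 S f ξ) 2 (haar S) := by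
      refine (memLp_congr_ae ?_).1 (Lp.memLp (fourierL2 S g)).neg
      filter_upwards [h] with ξ hξ
      rw [Pi.neg_apply, hξ, neg_neg]
    refine ⟨hmem, ?_⟩
    change g = -fourierInvL2 S (hmem.toLp _)
    rw [← map_neg, ← fourierInvL2_fourierL2 g]
    congr 1
    refine Lp.ext ?_
    filter_upwards [h, Lp.coeFn_neg (hmem.toLp _), hmem.coeFn_toLp] with ξ h1 h2 h3
    rw [h1, h2, Pi.neg_apply, h3]
  · rintro ⟨hf, rfl⟩
    have hmem : MemLp (fun ξ => ((ultraNorm ξ ^ α : ℝ) : ℂ) * fourierL2 S f ξ) 2 (haar S) := hf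
    have e : fourierL2 S (-Dop S α ⟨f, hf⟩) = -hmem.toLp _ := by
      rw [map_neg]
      exact congrArg Neg.neg (fourierL2_fourierInvL2 (hmem.toLp _))
    rw [e]
    filter_upwards [Lp.coeFn_neg (hmem.toLp _), hmem.coeFn_toLp] with ξ h2 h3
    rw [h2, Pi.neg_apply, h3]

theorem heatSemigroup_mem_domain (α : ℝ) {t : ℝ≥0} (ht : 0 < t) (f : L2 S) :
    (heatSemigroup S α).op t f ∈ (Dop S α).domain := by
  change MemLp (fun ξ => ((ultraNorm ξ ^ α : ℝ) : ℂ) *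
    fourierL2 S ((heatSemigroup S α).op t f) ξ) 2 (haar S)
  rw [fourierL2_heatSemigroup]
  exact memLp_mul_mulSemigroup _ _ ht _

/-! ### The heat kernel -/

theorem heatKernel_eq_fourierInv (α : ℝ) (t : ℝ) (x : QS S) :
    heatKernel α x t = fourierInv (fun ξ => (Real.exp (-t * ultraNorm ξ ^ α) : ℂ)) x := by
  simp only [heatKernel, fourierInv, mul_comm]

theorem integrable_char_mul_exp {α t : ℝ} (hα : 0 < α) (ht : 0 < t) (x : QS S) :
    Integrable (fun ξ => char (-(x * ξ)) * (Real.exp (-t * ultraNorm ξ ^ α) : ℂ)) (haar S) := by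
  refine (integrable_mul_char (integrable_exp_neg_mul_ultraNorm_rpow hα ht) (-x)).congr
    (Eventually.of_forall fun ξ => ?_)
  simp only
  rw [neg_mul x ξ, mul_comm]

/-- The kernel is in `L²`, as inverse transform of a function in `L¹ ∩ L²`; the Cauchy–Schwarz
inequality therefore applies at every `x`. -/
theorem integrable_mul_heatKernel {α t : ℝ} (hα : 0 < α) (ht : 0 < t) (f : L2 S) (x : QS S) :
    Integrable (fun y => f (x - y) * heatKernel α y t) (haar S) := by
  simp only [heatKernel_eq_fourierInv]
  exact (memLp_comp_sub_left (Lp.memLp f) x).integrable_mul (memLp_fourierInv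
    (integrable_exp_neg_mul_ultraNorm_rpow hα ht) (memLp_exp_neg_mul_ultraNorm_rpow hα ht))

theorem coeFn_heatSemigroup {α : ℝ} {t : ℝ≥0} (hα : 0 < α) (ht : 0 < t) (f : L2 S) :
    (heatSemigroup S α).op t f =ᵐ[haar S]
      fun x => ∫ y, f (x - y) * heatKernel α y t ∂(haar S) := by
  simp only [heatKernel_eq_fourierInv]
  exact coeFn_fourierInvL2_mul (integrable_exp_neg_mul_ultraNorm_rpow hα ht)
    (memLp_exp_neg_mul_ultraNorm_rpow hα ht) f _
    (coeFn_mulSemigroup (measurable_ultraNorm_rpow S α) (ultraNorm_rpow_nonneg α) t _)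

end SAdic

end

/-! ### The theorem. -/

open MeasureTheory SAdic in
theorem theorem6p1 (S : Finset Nat.Primes) (α : ℝ) (hα : 0 < α) :
    (∀ (x : QS S) (t : ℝ), 0 < t → Integrable
      (fun ξ => char (-(x * ξ)) * (Real.exp (-t * ultraNorm ξ ^ α) : ℂ)) (haar S)) ∧
    ∃ T : C0Semigroup (L2 S),
      (T.generator = -Dop S α ∧ ∀ T' : C0Semigroup (L2 S), T'.generator = -Dop S α → T' = T) ∧
      (∀ t : NNReal, 0 < t → ∀ f : L2 S, T.op t f ∈ (Dop S α).domain) ∧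
      ∀ f : L2 S, ∃ u : ℝ → L2 S,
        (IsCauchySolution (Dop S α) f u ∧
          ∀ v : ℝ → L2 S, IsCauchySolution (Dop S α) f v → Set.EqOn v u (Set.Ici 0)) ∧
        (∀ t : NNReal, u t = T.op t f) ∧
        ∀ t : ℝ, 0 < t →
          (∀ x, Integrable (fun y => f (x - y) * heatKernel α y t) (haar S)) ∧
          (u t : QS S → ℂ) =ᵐ[haar S] fun x => ∫ y, f (x - y) * heatKernel α y t ∂(haar S) := by
  have hgen := generator_heatSemigroup S α
  have hdom : ∀ t : NNReal, 0 < t → ∀ f : L2 S, (heatSemigroup S α).op t f ∈ (Dop S α).domain :=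
    fun t ht f => heatSemigroup_mem_domain α ht f
  -- Smoothing already yields density, since `T(t)f` lies in the domain and tends to `f` as `t →
  -- 0+`.
  have hdense : Dense ((heatSemigroup S α).generator.domain : Set (L2 S)) := by
    rw [hgen]
    exact C0Semigroup.dense_of_smoothing hdom
  refine ⟨fun x t ht => integrable_char_mul_exp hα ht x, heatSemigroup S α,
    ⟨hgen, fun T' hT' => C0Semigroup.eq_of_generator_eq (norm_heatSemigroup_le α) hdense
      (hT'.trans hgen.symm)⟩, hdom, fun f => ?_⟩
  have hu := C0Semigroup.isCauchySolution_orbit hgen hdom f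
  refine ⟨_, ⟨hu, fun v hv => C0Semigroup.isCauchySolution_unique (norm_heatSemigroup_le α)
    hgen hu hv⟩, fun t => by simp, fun t ht => ⟨integrable_mul_heatKernel hα ht f, ?_⟩⟩
  have := coeFn_heatSemigroup hα (t := t.toNNReal) (by simpa using ht) f
  rwa [Real.coe_toNNReal _ ht.le] at this
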